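/- Let $d$ be a prime, $\mathcal X=\mathbb F_d\times\mathbb F_d$ (the additive group of $\mathbb F_{d^2}$), and let $|0\rangle,\dots,|d-1\rangle$ be an orthonormal basis of $H=\mathbb C^d$. For a primitive $d$-th root of unity $\omega$ put $X|j\rangle=|j-1 \bmod d\rangle$, $Z|j\rangle=\omega^j|j\rangle$ and $E_{(i,j)}=X^iZ^j$ for $(i,j)\in\mathcal X$. A quantum discrete memoryless channel (QDMC) $\mathcal W$ is a family of operators $A_u=\sum_{v\in\mathcal X}a_{uv}E_v$ ($u\in\mathcal X$) such that $W(v)=\sum_{u}|a_{uv}|^2$ satisfies $\sum_{v\in\mathcal X}W(v)=1$; this holds in particular whenever $\sum_uA_u^*A_u=I$, that is, whenever $S\mapsto\sum_u A_uSA_u^*$ is trace preserving. On operators on $H_n=H^{\otimes n}$ it acts by $\mathcal W^{\otimes n}(S)=\sum_{u\in\mathcal X^n}A_uSA_u^*$, where $A_u=A_{u_1}\otimes\cdots\otimes A_{u_n}$. For a nonzero subspace $\mathcal Q\subseteq H_n$ of dimension $K$ let $R(\mathcal Q)=\frac1n\log_dK$. For a completely positive trace-preserving map $\mathcal R$ on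 the operators on $H_n$ let $$F(\mathcal Q,\mathcal R)=\frac1K\min_B\sum_{\psi\in B}\langle\psi|\,\mathcal R\big(\mathcal W^{\otimes n}(|\psi\rangle\langle\psi|)\big)|\psi\rangle,$$ the minimum being over all orthonormal bases $B$ of $\mathcal Q$. Put $$E(n,R,\mathcal W)=\sup_{\mathcal Q\ne 0,\ R(\mathcal Q)\ge R}\ \sup_{\mathcal R}\ \Big(-\frac1n\log_d\big(1-F(\mathcal Q,\mathcal R)\big)\Big)\in[0,\infty],\qquad E(R,\mathcal W)=\liminf_{n\to\infty}E(n,R,\mathcal W),$$ where $-\log_d(1-F)=\infty$ if $F\ge1$, and the supremum is $0$ if there is no code of rate at least $R$ (which happens for $R>1$). Then for every prime $d$, every QDMC $\mathcal W$ and every real $R\ge0$, $$E(R,\mathcal W)\ \ge\ E_r(R,\mathcal W)=\min_V\Big[D(V\|W)+|1-H(V)-R|^+\Big],$$ where $V$ runs over all probability distributions on $\mathcal X$ and the minimum is attained. Here $|a|^+=\max(a,0)$, $H(V)=-\sum_{x}V(x)\log_dV(x)$, and $D(V\|W)=\sum_xV(x)\log_d\frac{V(x)}{W(x)}$, which is $\infty$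 if $V(x)>0=W(x)$ for some $x$. -/

import Mathlib

open Filter
open scoped ENNReal Matrix ComplexOrder

namespace QDM

noncomputable section

/-! ### Error basis and quantum discrete memoryless channels -/

/-- The alphabet `𝒳`: the additive group of the field with `q = d ^ 2` elements, written as
pairs `(i, j)` of elements of `𝔽_d`. -/
abbrev Alphabet (d : ℕ) : Type := ZMod d × ZMod d

/-- The shift `X |j⟩ = |j - 1 mod d⟩`, as a matrix in the basis `|0⟩, …, |d - 1⟩`. -/
def shiftX (d : ℕ) : Matrix (ZMod d) (ZMod d) ℂ :=
  Matrix.of fun i j => if i = j - 1 then 1 else 0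

/-- The phase operator `Z |j⟩ = ω ^ j |j⟩`. -/
def phaseZ (d : ℕ) (ω : ℂ) : Matrix (ZMod d) (ZMod d) ℂ :=
  Matrix.diagonal fun j => ω ^ j.val

/-- The error basis `E_{i,j} = X ^ i Z ^ j`. -/
def errorOp (d : ℕ) [NeZero d] (ω : ℂ) (v : Alphabet d) : Matrix (ZMod d) (ZMod d) ℂ :=
  shiftX d ^ v.1.val * phaseZ d ω ^ v.2.val

/-- A quantum discrete memoryless channel: operators `A_u = ∑ v, a_{uv} E_v`, given by their
coefficients `a_{uv}` in the error basis, such that `W(v) = ∑ u, |a_{uv}| ^ 2` is a probability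
distribution. Normalisation of `W` is a consequence of trace preservation
(`∑ u, A_uᴴ * A_u = 1`); trace preservation itself is not demanded, so that all trace preserving
channels are covered. -/
structure QDMC (d : ℕ) [NeZero d] where
  coeff : Alphabet d → Alphabet d → ℂ
  sum_normSq : ∑ v, ∑ u, ‖coeff u v‖ ^ 2 = 1

namespace QDMC

variable {d : ℕ} [NeZero d]

/-- The probability distribution `W(v) = a_v a_v^*`, `a_v = (a_{uv})_u`. -/
def prob (W : QDMC d) (v : Alphabet d) : ℝ := ∑ u, ‖W.coeff u v‖ ^ 2

/-- The Kraus operators `A_u = ∑ v, a_{uv} E_v`. -/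
def kraus (ω : ℂ) (W : QDMC d) (u : Alphabet d) : Matrix (ZMod d) (ZMod d) ℂ :=
  ∑ v, W.coeff u v • errorOp d ω v

/-- The tensor products `A_{u_1} ⊗ ⋯ ⊗ A_{u_n}`, in the product basis of `(ℂ ^ d) ^ {⊗ n}`. -/
def krausPow (ω : ℂ) (W : QDMC d) (n : ℕ) (u : Fin n → Alphabet d) :
    Matrix (Fin n → ZMod d) (Fin n → ZMod d) ℂ :=
  Matrix.of fun x y => ∏ i, W.kraus ω (u i) (x i) (y i)

/-- The `n`-fold use `W^{⊗ n}` of the channel: `S ↦ ∑ u, A_u S A_u^*`, `u ∈ 𝒳 ^ n`. -/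
def apply (ω : ℂ) (W : QDMC d) (n : ℕ) (S : Matrix (Fin n → ZMod d) (Fin n → ZMod d) ℂ) :
    Matrix (Fin n → ZMod d) (Fin n → ZMod d) ℂ :=
  ∑ u : Fin n → Alphabet d, W.krausPow ω n u * S * (W.krausPow ω n u)ᴴ

end QDMC

/-! ### Recovery operators -/

/-- `Φ ⊗ id_k`, acting on `k × k` block matrices with blocks of index type `ι`. -/
def ampliation {ι : Type} (Φ : Matrix ι ι ℂ →ₗ[ℂ] Matrix ι ι ℂ) (k : ℕ)
    (M : Matrix (ι × Fin k) (ι × Fin k) ℂ) : Matrix (ι × Fin k) (ι × Fin k) ℂ :=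
  Matrix.of fun x y => Φ (Matrix.of fun i j => M (i, x.2) (j, y.2)) x.1 y.1

/-- Completely positive, trace preserving linear maps. -/
structure IsCPTP {ι : Type} [Fintype ι] (Φ : Matrix ι ι ℂ →ₗ[ℂ] Matrix ι ι ℂ) : Prop where
  completelyPositive : ∀ (k : ℕ) (M : Matrix (ι × Fin k) (ι × Fin k) ℂ),
    M.PosSemidef → (ampliation Φ k M).PosSemidef
  tracePreserving : ∀ S : Matrix ι ι ℂ, (Φ S).trace = S.trace

/-! ### Codes, fidelity, reliability -/

/-- The space `H_n = (ℂ ^ d) ^ {⊗ n}`, in the product basis `|x_1⟩ ⊗ ⋯ ⊗ |x_n⟩`. -/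
abbrev Space (d n : ℕ) : Type := EuclideanSpace ℂ (Fin n → ZMod d)

/-- Operators on `H_n`. -/
abbrev Op (d n : ℕ) : Type := Matrix (Fin n → ZMod d) (Fin n → ZMod d) ℂ

/-- The projector `|ψ⟩⟨ψ|`. -/
def ketbra {d n : ℕ} (ψ : Space d n) : Op d n :=
  Matrix.vecMulVec ψ.ofLp (star ψ.ofLp)

/-- The (real) number `⟨ψ| S |ψ⟩` for a Hermitian `S`. -/
def expect {d n : ℕ} [NeZero d] (S : Op d n) (ψ : Space d n) : ℝ :=
  (star ψ.ofLp ⬝ᵥ (S *ᵥ ψ.ofLp)).re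

/-- The rate `(log_d K) / n` of a code of dimension `K`. -/
def rate {d n : ℕ} [NeZero d] (Q : Submodule ℂ (Space d n)) : ℝ :=
  Real.logb d (Module.finrank ℂ Q) / n

/-- The fidelity of the code `Q` with recovery operator `Rec`: the minimum over all orthonormal
bases `B` of `Q` of `K⁻¹ ∑_{ψ ∈ B} ⟨ψ| Rec (W^{⊗ n} (|ψ⟩⟨ψ|)) |ψ⟩`. -/
def fidelity {d n : ℕ} [NeZero d] (ω : ℂ) (W : QDMC d) (Q : Submodule ℂ (Space d n))
    (Rec : Op d n →ₗ[ℂ] Op d n) : ℝ :=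
  ⨅ B : OrthonormalBasis (Fin (Module.finrank ℂ Q)) ℂ Q,
    (1 / (Module.finrank ℂ Q : ℝ)) *
      ∑ i, expect (Rec (W.apply ω n (ketbra (B i : Space d n)))) (B i : Space d n)

/-- `-(1 / n) log_d ε` in `[0, ∞]`, for `ε ≤ 1`; it is `∞` at `ε = 0`. -/
def exponent (d n : ℕ) (ε : ℝ) : ℝ≥0∞ :=
  if ε ≤ 0 then ⊤ else ENNReal.ofReal (-(1 / (n : ℝ)) * Real.logb d ε)

/-- `E(n, R, W)`: the supremum, in `[0, ∞]`, of `-(1 / n) log_d (1 - F)` over all nonzero codes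
in `H_n` of rate at least `R`, with all recovery operators. -/
def errorExponent (d : ℕ) [NeZero d] (ω : ℂ) (W : QDMC d) (n : ℕ) (R : ℝ) : ℝ≥0∞ :=
  ⨆ (Q : Submodule ℂ (Space d n)) (_ : Q ≠ ⊥) (_ : R ≤ rate Q)
    (Rec : Op d n →ₗ[ℂ] Op d n) (_ : IsCPTP Rec), exponent d n (1 - fidelity ω W Q Rec)

/-- The reliability `E(R, W) = liminf E(n, R, W)`. -/
def reliability (d : ℕ) [NeZero d] (ω : ℂ) (W : QDMC d) (R : ℝ) : ℝ≥0∞ :=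
  liminf (fun n : ℕ => errorExponent d ω W n R) atTop

/-! ### The random coding exponent -/

/-- The entropy `H_m(P)`, to base `m`. -/
def entropy {α : Type} [Fintype α] (m : ℝ) (P : α → ℝ) : ℝ :=
  -∑ x, P x * Real.logb m (P x)

open Classical in
/-- The divergence `D_m(Q ‖ P)` of probability distributions, to base `m`; it is `∞` unless
`Q` vanishes where `P` does. -/
def divergence {α : Type} [Fintype α] (m : ℝ) (Q P : α → ℝ) : ℝ≥0∞ :=
  if ∀ x, P x = 0 → Q x = 0 then ENNReal.ofReal (∑ x, Q x * Real.logb m (Q x / P x)) else ⊤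

/-- `D(V ‖ W) + |1 - H(V) - R|^+`, logarithms to base `d`. -/
def randomCodingTerm (d : ℕ) [NeZero d] (W : QDMC d) (R : ℝ) (V : Alphabet d → ℝ) : ℝ≥0∞ :=
  divergence d V W.prob + ENNReal.ofReal (max (1 - entropy d V - R) 0)

/-- `E_r(R, W)`: the infimum of `D(V ‖ W) + |1 - H(V) - R|^+` over all probability distributions
`V` on `𝒳`. -/
def randomCodingExponent (d : ℕ) [NeZero d] (W : QDMC d) (R : ℝ) : ℝ≥0∞ :=
  ⨅ V ∈ stdSimplex ℝ (Alphabet d), randomCodingTerm d W R V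

end

end QDM

/-! Random stabilizer codes achieve the exponent. The operators `E_y`, for `y` in an isotropic group
`L` of order `d ^ (n - k)`, commute; rescaled by phases they represent `L`, and each character `χ`
of `L` has an eigenspace of dimension `d ^ k`. An error `E_v` moves these eigenspaces according to
its syndrome, so recovery measures the syndrome and undoes a chosen leader with that syndrome. The
aim is to correct every `v` that differs from its leader by an element of `L`.

The channel is not a mixture of the `E_v`: its Kraus operators are superpositions, and errors in one
coset of `L` interfere. Cauchy–Schwarz bounds the fidelity below by squared traces that do not
depend on the basis (`le_fidelity`). These traces are Fourier sums over `L` evaluated at `χ`, and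
Parseval over all `χ` removes the cross terms. So for some `χ` the fidelity is at least the `W ^
n`-probability of the correctable errors (`exists_code`), and only `W` matters from then on.

Take for `L` a random symplectic image of a fixed isotropic group. By transitivity, a given nonzero
vector is orthogonal to `L` with probability at most `d ^ (-(n - k))`. If leaders have least
empirical entropy, the union bound says that `x` fails with probability at most `min 1 (N x / d ^ (n
- k))`, where `N x` counts the words of entropy at most that of `x` (`exists_isotropic`). Up to
polynomial factors `N x` is at most `d ^ (n H)`, and a type `V` has probability at most `d ^ (-n
D(V‖W))`. There are polynomially many types, so `k ≈ n R` gives total error `d ^ (-n E_r)` up to a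
polynomial factor (`sum_min_le`). -/

namespace QDM

noncomputable section

/-! ### The symplectic form and the Pauli group -/

/-- The symplectic form on `𝒳 ^ n`. -/
def symp {d n : ℕ} (u v : Fin n → Alphabet d) : ZMod d :=
  ∑ i, ((u i).1 * (v i).2 - (u i).2 * (v i).1)

section Symp

variable {d n : ℕ}

theorem symp_add_left (u u' v : Fin n → Alphabet d) : symp (u + u') v = symp u v + symp u' v := by
  simp only [symp, ← Finset.sum_add_distrib]
  exact Finset.sum_congr rfl fun i _ => by simp only [Pi.add_apply, Prod.fst_add, Prod.snd_add]; ring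

theorem symp_swap (u v : Fin n → Alphabet d) : symp u v = -symp v u := by
  simp only [symp, ← Finset.sum_neg_distrib]
  exact Finset.sum_congr rfl fun i _ => by ring

theorem symp_self (u : Fin n → Alphabet d) : symp u u = 0 :=
  Finset.sum_eq_zero fun i _ => by ring

theorem symp_add_right (u v v' : Fin n → Alphabet d) : symp u (v + v') = symp u v + symp u v' := by
  rw [symp_swap, symp_add_left, symp_swap u v, symp_swap u v']; ring

theorem symp_smul_left (c : ZMod d) (u v : Fin n → Alphabet d) :
    symp (c • u) v = c * symp u v := by
  simp only [symp, Finset.mul_sum]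
  exact Finset.sum_congr rfl fun i _ => by
    simp only [Pi.smul_apply, Prod.smul_fst, Prod.smul_snd, smul_eq_mul]; ring

theorem symp_smul_right (c : ZMod d) (u v : Fin n → Alphabet d) :
    symp u (c • v) = c * symp u v := by
  rw [symp_swap, symp_smul_left, symp_swap u v]; ring

theorem symp_zero_left (v : Fin n → Alphabet d) : symp 0 v = 0 := by simp [symp]

theorem symp_neg_left (u v : Fin n → Alphabet d) : symp (-u) v = -symp u v := by
  rw [← neg_one_smul (ZMod d) u, symp_smul_left, neg_one_mul]

theorem symp_sub_left (u u' v : Fin n → Alphabet d) : symp (u - u') v = symp u v - symp u' v := by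
  rw [sub_eq_add_neg, symp_add_left, symp_neg_left, sub_eq_add_neg]

/-- Nondegeneracy: a nonzero coordinate is detected by one of the two unit vectors at that position.
-/
theorem exists_symp_ne_zero [Fact d.Prime] {u : Fin n → Alphabet d} (hu : u ≠ 0) :
    ∃ v, symp u v ≠ 0 := by
  obtain ⟨i, hi⟩ := Function.ne_iff.1 hu
  have key (a : Alphabet d) :
      symp u (Pi.single i a) = (u i).1 * a.2 - (u i).2 * a.1 := by
    rw [symp, Finset.sum_eq_single i]
    · simp
    · intro j _ hj; simp [Pi.single_eq_of_ne hj]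
    · simp
  by_cases h : (u i).1 = 0
  · refine ⟨Pi.single i (1, 0), ?_⟩
    rw [key]
    have : (u i).2 ≠ 0 := fun h2 => hi (Prod.ext h h2)
    simpa using this
  · refine ⟨Pi.single i (0, 1), ?_⟩
    rw [key]
    simpa using h

end Symp

/-- The tensor products `E_{v_1} ⊗ ⋯ ⊗ E_{v_n}`, for the character `ψ = ω ^ ·`. -/
def pauli {d n : ℕ} (ψ : AddChar (ZMod d) ℂ) (v : Fin n → Alphabet d) : Op d n :=
  Matrix.of fun x y => if x = y - fun i => (v i).1 then ψ (∑ i, (v i).2 * y i) else 0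

theorem pauli_zero {d n : ℕ} (ψ : AddChar (ZMod d) ℂ) : pauli ψ (0 : Fin n → Alphabet d) = 1 := by
  ext x y
  have : (y - fun _ => (0 : ZMod d)) = y := sub_zero y
  simp [pauli, Matrix.one_apply, this]

theorem addChar_map_sum {A ι : Type*} [AddCommMonoid A] (ψ : AddChar A ℂ) (s : Finset ι)
    (f : ι → A) : ψ (∑ i ∈ s, f i) = ∏ i ∈ s, ψ (f i) :=
  map_prod ψ.toMonoidHom (fun i => Multiplicative.ofAdd (f i)) s

/-! ### Algebra of the error operators -/

section Pauli

variable {d n : ℕ} [NeZero d]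

theorem shiftX_pow (k : ℕ) :
    shiftX d ^ k = Matrix.of fun i j => if i = j - (k : ZMod d) then 1 else 0 := by
  induction k with
  | zero => ext i j; simp [Matrix.one_apply]
  | succ k ih =>
    ext i j
    rw [pow_succ, ih, shiftX, Matrix.mul_apply, Finset.sum_eq_single (j - 1)]
    · simp only [Matrix.of_apply, if_true, mul_one, Nat.cast_add, Nat.cast_one]
      congr 2
      ring
    · intro b _ hb; simp [hb]
    · simp

/-- Replacing powers of `ω` by an additive character lets exponents live in `ZMod d`, so no
reduction modulo `d` is needed later. -/
theorem errorOp_apply {ω : ℂ} (h : ω ^ d = 1) (v : Alphabet d) (x y : ZMod d) :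
    errorOp d ω v x y = if x = y - v.1 then AddChar.zmodChar d h (v.2 * y) else 0 := by
  rw [errorOp, shiftX_pow, phaseZ, Matrix.diagonal_pow, Matrix.mul_diagonal, Matrix.of_apply,
    ZMod.natCast_zmod_val]
  split_ifs with hx
  · have : v.2 * y = ((y.val * v.2.val : ℕ) : ZMod d) := by
      push_cast; rw [ZMod.natCast_zmod_val, ZMod.natCast_zmod_val, mul_comm]
    rw [one_mul, this, AddChar.zmodChar_apply', Pi.pow_apply, pow_mul]
  · rw [zero_mul]

theorem prod_errorOp {ω : ℂ} (h : ω ^ d = 1) (v : Fin n → Alphabet d) (x y : Fin n → ZMod d) :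
    ∏ i, errorOp d ω (v i) (x i) (y i) = pauli (AddChar.zmodChar d h) v x y := by
  simp only [errorOp_apply h, pauli, Matrix.of_apply]
  split_ifs with hx
  · rw [addChar_map_sum]
    refine Finset.prod_congr rfl fun i _ => ?_
    rw [if_pos (by simpa using congrFun hx i)]
  · obtain ⟨i, hi⟩ := Function.ne_iff.1 hx
    exact Finset.prod_eq_zero (Finset.mem_univ i) (if_neg hi)

/-- The coefficients of `A_{u_1} ⊗ ⋯ ⊗ A_{u_n}` in the error basis. -/
def QDMC.coeffPow (W : QDMC d) (u v : Fin n → Alphabet d) : ℂ := ∏ i, W.coeff (u i) (v i)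

/-- The product distribution `W ^ n`. -/
def QDMC.probPow (W : QDMC d) (v : Fin n → Alphabet d) : ℝ := ∏ i, W.prob (v i)

theorem QDMC.krausPow_eq {ω : ℂ} (h : ω ^ d = 1) (W : QDMC d) (u : Fin n → Alphabet d) :
    W.krausPow ω n u = ∑ v, W.coeffPow u v • pauli (AddChar.zmodChar d h) v := by
  ext x y
  simp only [krausPow, Matrix.of_apply, kraus, Matrix.sum_apply, Matrix.smul_apply, smul_eq_mul]
  rw [Finset.prod_univ_sum, Fintype.piFinset_univ]
  refine Finset.sum_congr rfl fun v _ => ?_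
  rw [Finset.prod_mul_distrib, prod_errorOp h, coeffPow]

theorem QDMC.sum_coeffPow (W : QDMC d) (v : Fin n → Alphabet d) :
    ∑ u, ‖W.coeffPow u v‖ ^ 2 = W.probPow v := by
  simp only [coeffPow, probPow, prob]
  rw [Finset.prod_univ_sum, Fintype.piFinset_univ]
  simp [Finset.prod_pow]

theorem QDMC.prob_nonneg (W : QDMC d) (v : Alphabet d) : 0 ≤ W.prob v :=
  Finset.sum_nonneg fun _ _ => by positivity

theorem QDMC.probPow_nonneg (W : QDMC d) (v : Fin n → Alphabet d) : 0 ≤ W.probPow v :=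
  Finset.prod_nonneg fun _ _ => W.prob_nonneg _

theorem QDMC.sum_prob (W : QDMC d) : ∑ v, W.prob v = 1 := W.sum_normSq

theorem sum_prod_eq_one {α : Type*} [Fintype α] {P : α → ℝ} (h : ∑ a, P a = 1) :
    ∑ v : Fin n → α, ∏ i, P (v i) = 1 := by
  classical
  rw [← Fintype.piFinset_univ, ← Finset.prod_univ_sum]
  simp [h]

theorem QDMC.sum_probPow (W : QDMC d) : ∑ v : Fin n → Alphabet d, W.probPow v = 1 :=
  sum_prod_eq_one W.sum_prob

variable (ψ : AddChar (ZMod d) ℂ)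

theorem pauli_mul (u v : Fin n → Alphabet d) :
    pauli ψ u * pauli ψ v = ψ (-∑ i, (u i).2 * (v i).1) • pauli ψ (u + v) := by
  ext x y
  rw [Matrix.mul_apply, Finset.sum_eq_single (y - fun i => (v i).1)]
  · simp only [pauli, Matrix.of_apply, if_true, Matrix.smul_apply, smul_eq_mul]
    have : (y - fun i => ((u + v) i).1) = (y - fun i => (v i).1) - fun i => (u i).1 := by
      funext i; simp only [Pi.sub_apply, Pi.add_apply, Prod.fst_add]; ring
    rw [this]
    split_ifs with hx
    · rw [← AddChar.map_add_eq_mul, ← AddChar.map_add_eq_mul, ← Finset.sum_neg_distrib,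
        ← Finset.sum_add_distrib, ← Finset.sum_add_distrib]
      congr 1
      refine Finset.sum_congr rfl fun i _ => ?_
      simp only [Pi.sub_apply, Pi.add_apply, Prod.snd_add]; ring
    · simp
  · intro z _ hz
    simp [pauli, hz]
  · simp

theorem pauli_conjTranspose (v : Fin n → Alphabet d) :
    (pauli ψ v)ᴴ = ψ (-∑ i, (v i).2 * (v i).1) • pauli ψ (-v) := by
  ext x y
  simp only [pauli, Matrix.conjTranspose_apply, Matrix.of_apply, Matrix.smul_apply, smul_eq_mul]
  have : (y = x - fun i => (v i).1) ↔ (x = y - fun i => ((-v) i).1) := by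
    have : (fun i => ((-v) i).1) = -fun i => (v i).1 := by funext i; simp
    rw [this, sub_neg_eq_add, eq_sub_iff_add_eq, eq_comm]
  split_ifs with h1 h2 h2
  · rw [← AddChar.map_add_eq_mul, RCLike.star_def, ← AddChar.map_neg_eq_conj,
      ← Finset.sum_neg_distrib, ← Finset.sum_neg_distrib, ← Finset.sum_add_distrib]
    congr 1
    refine Finset.sum_congr rfl fun i _ => ?_
    rw [congrFun (this.1 h1) i]
    simp only [Pi.sub_apply, Pi.neg_apply, Prod.snd_neg, Prod.fst_neg]; ring
  · exact absurd (this.1 h1) h2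
  · exact absurd (this.2 h2) h1
  · simp

theorem pauli_conjTranspose_mul_self (v : Fin n → Alphabet d) :
    (pauli ψ v)ᴴ * pauli ψ v = 1 := by
  rw [pauli_conjTranspose, smul_mul_assoc, pauli_mul, neg_add_cancel, pauli_zero, smul_smul,
    ← AddChar.map_add_eq_mul]
  simp

theorem pauli_mul_conjTranspose_self (v : Fin n → Alphabet d) :
    pauli ψ v * (pauli ψ v)ᴴ = 1 :=
  mul_eq_one_comm.1 (pauli_conjTranspose_mul_self ψ v)

theorem pauli_mul_comm (u v : Fin n → Alphabet d) :
    pauli ψ u * pauli ψ v = ψ (symp u v) • (pauli ψ v * pauli ψ u) := by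
  rw [pauli_mul, pauli_mul, smul_smul, ← AddChar.map_add_eq_mul, add_comm v u]
  congr 2
  rw [symp, ← Finset.sum_neg_distrib, ← Finset.sum_neg_distrib, ← Finset.sum_add_distrib]
  exact Finset.sum_congr rfl fun i _ => by ring

/-- Conjugation by some `E_w` preserves the trace but multiplies `E_v` by a scalar other than 1. -/
theorem trace_pauli [Fact d.Prime] (hψ : ∀ a, ψ a = 1 → a = 0) {v : Fin n → Alphabet d}
    (hv : v ≠ 0) : (pauli ψ v).trace = 0 := by
  obtain ⟨w, hw⟩ := exists_symp_ne_zero hv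
  have h1 : (pauli ψ v).trace = ψ (symp v w) * (pauli ψ v).trace := by
    have := congrArg (fun M => ((pauli ψ w)ᴴ * M).trace) (pauli_mul_comm ψ v w)
    simp only [mul_smul_comm, Matrix.trace_smul, ← mul_assoc, pauli_conjTranspose_mul_self,
      one_mul, smul_eq_mul] at this
    rw [← this, Matrix.trace_mul_comm, ← mul_assoc, pauli_mul_conjTranspose_self, one_mul]
  by_contra h
  exact hw (hψ _ (mul_right_cancel₀ h (by rw [one_mul]; exact h1.symm)))

theorem norm_mulVec_pauli (v : Fin n → Alphabet d) (φ : (Fin n → ZMod d) → ℂ) :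
    star (pauli ψ v *ᵥ φ) ⬝ᵥ (pauli ψ v *ᵥ φ) = star φ ⬝ᵥ φ := by
  rw [Matrix.star_mulVec, Matrix.dotProduct_mulVec, Matrix.vecMul_vecMul,
    pauli_conjTranspose_mul_self, Matrix.vecMul_one]

end Pauli

/-! ### Commuting families have a common eigenvector -/

/-- On a minimal nonzero invariant subspace every operator is scalar: its eigenspace there is again
invariant, by commutation, hence everything. -/
theorem exists_common_eigenvector {ι E : Type*} [AddCommGroup E] [Module ℂ E]
    [FiniteDimensional ℂ E] [Nontrivial E] (f : ι → Module.End ℂ E)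
    (hf : ∀ i j, Commute (f i) (f j)) : ∃ v : E, v ≠ 0 ∧ ∀ i, ∃ μ : ℂ, f i v = μ • v := by
  let S : Set (Submodule ℂ E) := {U | U ≠ ⊥ ∧ ∀ i, ∀ v ∈ U, f i v ∈ U}
  obtain ⟨U, ⟨hU, hUf⟩, hmin⟩ := (wellFounded_lt (α := Submodule ℂ E)).has_min S
    ⟨⊤, top_ne_bot, fun _ _ _ => trivial⟩
  obtain ⟨v, hvU, hv⟩ := Submodule.exists_mem_ne_zero_of_ne_bot hU
  refine ⟨v, hv, fun i => ?_⟩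
  have : Nontrivial U := Submodule.nontrivial_iff_ne_bot.2 hU
  obtain ⟨μ, hμ⟩ := Module.End.exists_eigenvalue ((f i).restrict (hUf i))
  obtain ⟨w, hw⟩ := hμ.exists_hasEigenvector
  have hle : U ⊓ (f i).eigenspace μ = U := by
    refine (eq_of_le_of_not_lt inf_le_left (hmin _ ⟨?_, ?_⟩))
    · refine Submodule.ne_bot_iff _ |>.2 ⟨w, ⟨w.2, ?_⟩, fun h => hw.2 (Subtype.ext h)⟩
      rw [SetLike.mem_coe, Module.End.mem_eigenspace_iff]
      exact congrArg Subtype.val hw.apply_eq_smul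
    · rintro j x ⟨hx, hx'⟩
      refine ⟨hUf j x hx, ?_⟩
      rw [SetLike.mem_coe, Module.End.mem_eigenspace_iff] at hx' ⊢
      rw [← Module.End.mul_apply, hf i j, Module.End.mul_apply, hx', map_smul]
  refine ⟨μ, ?_⟩
  rw [← hle] at hvU
  exact Module.End.mem_eigenspace_iff.1 hvU.2

/-! ### Maps in Kraus form -/

section Kraus

variable {ι κ : Type} [Fintype ι] [Fintype κ]

/-- The map `S ↦ ∑ t, K_t S K_t^*`. -/
def krausMap (K : κ → Matrix ι ι ℂ) : Matrix ι ι ℂ →ₗ[ℂ] Matrix ι ι ℂ where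
  toFun S := ∑ t, K t * S * (K t)ᴴ
  map_add' S T := by simp [mul_add, add_mul, Finset.sum_add_distrib]
  map_smul' c S := by simp [Finset.smul_sum]

theorem krausMap_apply (K : κ → Matrix ι ι ℂ) (S : Matrix ι ι ℂ) :
    krausMap K S = ∑ t, K t * S * (K t)ᴴ := rfl

/-- The ampliation is again in Kraus form, with operators `K_t ⊗ 1`; complete positivity is then
immediate. -/
theorem ampliation_krausMap (K : κ → Matrix ι ι ℂ) (k : ℕ)
    (M : Matrix (ι × Fin k) (ι × Fin k) ℂ) :
    ampliation (krausMap K) k M =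
      ∑ t, (Matrix.kroneckerMap (· * ·) (K t) (1 : Matrix (Fin k) (Fin k) ℂ)) * M *
        (Matrix.kroneckerMap (· * ·) (K t) (1 : Matrix (Fin k) (Fin k) ℂ))ᴴ := by
  ext ⟨x, a⟩ ⟨y, b⟩
  simp only [ampliation, krausMap_apply, Matrix.of_apply, Matrix.sum_apply]
  refine Finset.sum_congr rfl fun t _ => ?_
  simp only [Matrix.mul_apply, Matrix.conjTranspose_apply, Matrix.of_apply,
    Matrix.kroneckerMap_apply, Fintype.sum_prod_type]
  refine Finset.sum_congr rfl fun j _ => ?_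
  rw [Finset.sum_eq_single b]
  · congr 1
    · refine Finset.sum_congr rfl fun i _ => ?_
      rw [Finset.sum_eq_single a]
      · simp
      · intro c _ hc; simp [Matrix.one_apply_ne hc.symm]
      · simp
    · simp
  · intro c _ hc; simp [Matrix.one_apply_ne hc.symm]
  · simp

theorem isCPTP_krausMap [DecidableEq ι] (K : κ → Matrix ι ι ℂ) (h : ∑ t, (K t)ᴴ * K t = 1) :
    IsCPTP (krausMap K) where
  completelyPositive k M hM := by
    rw [ampliation_krausMap]
    exact Matrix.posSemidef_sum _ fun t _ => hM.mul_mul_conjTranspose_same _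
  tracePreserving S := by
    rw [krausMap_apply, Matrix.trace_sum]
    have (t : κ) : (K t * S * (K t)ᴴ).trace = ((K t)ᴴ * K t * S).trace := by
      rw [Matrix.trace_mul_comm, mul_assoc]
    simp only [this]
    rw [← Matrix.trace_sum, ← Finset.sum_mul, h, one_mul]

end Kraus

/-! ### Fidelity of the range of a projection -/

section Fidelity

variable {d n : ℕ} [NeZero d]

theorem expect_sum {κ : Type*} (s : Finset κ) (f : κ → Op d n) (φ : Space d n) :
    expect (∑ t ∈ s, f t) φ = ∑ t ∈ s, expect (f t) φ := by
  simp only [expect, Matrix.sum_mulVec, dotProduct_sum, Complex.re_sum]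

theorem expect_mul_ketbra (M : Op d n) (φ : Space d n) :
    expect (M * ketbra φ * Mᴴ) φ = ‖star φ.ofLp ⬝ᵥ (M *ᵥ φ.ofLp)‖ ^ 2 := by
  have h1 : M * ketbra φ * Mᴴ
      = Matrix.vecMulVec (M *ᵥ φ.ofLp) (star (M *ᵥ φ.ofLp)) := by
    rw [ketbra, Matrix.mul_vecMulVec, Matrix.vecMulVec_mul, Matrix.star_mulVec]
  have h2 : star (M *ᵥ φ.ofLp) ⬝ᵥ φ.ofLp = star (star φ.ofLp ⬝ᵥ (M *ᵥ φ.ofLp)) := by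
    rw [Matrix.star_dotProduct]
  rw [expect, h1, Matrix.vecMulVec_mulVec, h2]
  simp only [dotProduct_smul, MulOpposite.smul_eq_mul_unop, MulOpposite.unop_op]
  rw [RCLike.star_def, Complex.mul_conj, Complex.ofReal_re, Complex.normSq_eq_norm_sq]

/-- The range of a matrix. -/
def rangeOf (P : Op d n) : Submodule ℂ (Space d n) := LinearMap.range (Matrix.toEuclideanLin P)

variable {P : Op d n}

theorem eq_sum_ketbra (hP : P * P = P) (hP' : Pᴴ = P) {κ : Type*} [Fintype κ]
    (b : OrthonormalBasis κ ℂ (rangeOf P)) : P = ∑ i, ketbra (b i : Space d n) := by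
  have hfix (x : rangeOf P) : P *ᵥ (x : Space d n).ofLp = (x : Space d n).ofLp := by
    obtain ⟨_, ⟨y, rfl⟩⟩ := x
    simp [Matrix.toLpLin_apply, Matrix.mulVec_mulVec, hP]
  refine Matrix.ext_of_mulVec_single fun j => ?_
  set x : (Fin n → ZMod d) → ℂ := Pi.single j 1
  have h1 := b.sum_repr' ⟨Matrix.toEuclideanLin P (WithLp.toLp 2 x), LinearMap.mem_range_self _ _⟩
  have h2 := congrArg (fun z : rangeOf P => (z : Space d n).ofLp) h1
  simp only [Submodule.coe_sum, Submodule.coe_smul, WithLp.ofLp_sum, WithLp.ofLp_smul,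
    Submodule.coe_inner] at h2
  have h3 : (Matrix.toEuclideanLin P (WithLp.toLp 2 x)).ofLp = P *ᵥ x := by
    simp [Matrix.toLpLin_apply]
  rw [h3] at h2
  rw [← h2, Matrix.sum_mulVec]
  refine Finset.sum_congr rfl fun i _ => ?_
  rw [ketbra, Matrix.vecMulVec_mulVec, op_smul_eq_smul,
    EuclideanSpace.inner_eq_star_dotProduct, h3]
  congr 1
  have hf := Matrix.star_mulVec P (b i : Space d n).ofLp
  rw [hfix, hP'] at hf
  rw [dotProduct_comm, Matrix.dotProduct_mulVec, ← hf]

/-- The right side does not involve the basis, which is what controls the minimum over bases in the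
fidelity. -/
theorem sum_dotProduct_eq_trace (hP : P * P = P) (hP' : Pᴴ = P) {κ : Type*} [Fintype κ]
    (b : OrthonormalBasis κ ℂ (rangeOf P)) (M : Op d n) :
    ∑ i, star (b i : Space d n).ofLp ⬝ᵥ (M *ᵥ (b i : Space d n).ofLp) = (P * M).trace := by
  conv_rhs => rw [eq_sum_ketbra hP hP' b, Finset.sum_mul, Matrix.trace_sum]
  refine Finset.sum_congr rfl fun i _ => ?_
  rw [ketbra, Matrix.trace_mul_comm, Matrix.mul_vecMulVec, Matrix.trace_vecMulVec, dotProduct_comm]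

theorem finrank_rangeOf (hP : P * P = P) (hP' : Pᴴ = P) :
    (Module.finrank ℂ (rangeOf P) : ℂ) = P.trace := by
  have b := stdOrthonormalBasis ℂ (rangeOf P)
  have h := sum_dotProduct_eq_trace hP hP' b 1
  rw [mul_one] at h
  rw [← h]
  have (i : Fin (Module.finrank ℂ (rangeOf P))) :
      star (b i : Space d n).ofLp ⬝ᵥ ((1 : Op d n) *ᵥ (b i : Space d n).ofLp) = 1 := by
    rw [Matrix.one_mulVec, dotProduct_comm, ← EuclideanSpace.inner_eq_star_dotProduct,
      ← Submodule.coe_inner, inner_self_eq_norm_sq_to_K, b.orthonormal.1 i]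
    simp
  rw [Finset.sum_congr rfl fun i _ => this i]
  simp

theorem norm_sum_sq_div_le {k : ℕ} (z : Fin k → ℂ) :
    ‖∑ i, z i‖ ^ 2 / (k : ℝ) ^ 2 ≤ 1 / (k : ℝ) * ∑ i, ‖z i‖ ^ 2 := by
  rcases Nat.eq_zero_or_pos k with rfl | hk
  · simp
  have hk' : (0 : ℝ) < k := by exact_mod_cast hk
  rw [div_le_iff₀ (by positivity)]
  calc ‖∑ i, z i‖ ^ 2 ≤ (∑ i, ‖z i‖) ^ 2 := by gcongr; exact norm_sum_le _ _
    _ ≤ (Finset.univ : Finset (Fin k)).card * ∑ i, ‖z i‖ ^ 2 := sq_sum_le_card_mul_sum_sq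
    _ = k * ∑ i, ‖z i‖ ^ 2 := by simp
    _ = 1 / k * (∑ i, ‖z i‖ ^ 2) * k ^ 2 := by field_simp

/-- For `M = K_t A_u`, Cauchy–Schwarz bounds the average of `|⟨b|M|b⟩|²` over a basis of the code
below by the squared modulus of the average of `⟨b|M|b⟩`, which is `tr (P M) / tr P`. -/
theorem le_fidelity (ω : ℂ) (W : QDMC d) (hP : P * P = P) (hP' : Pᴴ = P) {κ : Type} [Fintype κ]
    (K : κ → Op d n) :
    ∑ t, ∑ u, ‖(P * (K t * W.krausPow ω n u)).trace‖ ^ 2 / ‖P.trace‖ ^ 2 ≤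
      fidelity ω W (rangeOf P) (krausMap K) := by
  have : Nonempty (OrthonormalBasis (Fin (Module.finrank ℂ (rangeOf P))) ℂ (rangeOf P)) :=
    ⟨stdOrthonormalBasis ℂ (rangeOf P)⟩
  refine le_ciInf fun b => ?_
  have hex (i) : expect (krausMap K (W.apply ω n (ketbra (b i : Space d n)))) (b i : Space d n) =
      ∑ t, ∑ u, ‖star (b i : Space d n).ofLp ⬝ᵥ
        ((K t * W.krausPow ω n u) *ᵥ (b i : Space d n).ofLp)‖ ^ 2 := by
    rw [krausMap_apply, expect_sum]
    refine Finset.sum_congr rfl fun t _ => ?_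
    rw [QDMC.apply, Finset.mul_sum, Finset.sum_mul, expect_sum]
    refine Finset.sum_congr rfl fun u _ => ?_
    rw [← expect_mul_ketbra, Matrix.conjTranspose_mul]
    simp only [mul_assoc]
  rw [Finset.sum_congr rfl fun i _ => hex i, Finset.sum_comm (s := Finset.univ (α := Fin _)),
    Finset.mul_sum]
  refine Finset.sum_le_sum fun t _ => ?_
  rw [Finset.sum_comm (s := Finset.univ (α := Fin _)), Finset.mul_sum]
  refine Finset.sum_le_sum fun u _ => ?_
  rw [← sum_dotProduct_eq_trace hP hP' b, ← finrank_rangeOf hP hP', Complex.norm_natCast]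
  exact norm_sum_sq_div_le _

end Fidelity

/-! ### Stabilizer codes -/

section Syndrome

variable {d n : ℕ}

/-- The syndrome of `v`: the character `y ↦ ψ (symp y v)` of `L`. -/
def syndrome (ψ : AddChar (ZMod d) ℂ) (L : AddSubgroup (Fin n → Alphabet d))
    (v : Fin n → Alphabet d) : AddChar L ℂ where
  toFun y := ψ (symp y.1 v)
  map_zero_eq_one' := by simp [symp_zero_left]
  map_add_eq_mul' y z := by
    rw [AddSubgroup.coe_add, symp_add_left, AddChar.map_add_eq_mul]

variable {ψ : AddChar (ZMod d) ℂ} {L : AddSubgroup (Fin n → Alphabet d)}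

theorem syndrome_apply (v : Fin n → Alphabet d) (y : L) : syndrome ψ L v y = ψ (symp y.1 v) := rfl

theorem syndrome_eq_iff (hψ : ∀ a, ψ a = 1 → a = 0) (v w : Fin n → Alphabet d) :
    syndrome ψ L v = syndrome ψ L w ↔ ∀ y ∈ L, symp (v - w) y = 0 := by
  have key (y : L) : syndrome ψ L v y = syndrome ψ L w y ↔ symp (v - w) y.1 = 0 := by
    rw [syndrome_apply, syndrome_apply, symp_sub_left, symp_swap v, symp_swap w]
    constructor
    · intro h
      have h1 : ψ (symp y.1 v - symp y.1 w) = 1 := by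
        rw [sub_eq_add_neg, AddChar.map_add_eq_mul, h, ← AddChar.map_add_eq_mul, add_neg_cancel,
          AddChar.map_zero_eq_one]
      linear_combination -hψ _ h1
    · intro h
      congr 1
      linear_combination -h
  constructor
  · intro h y hy
    exact (key ⟨y, hy⟩).1 (by rw [h])
  · intro h
    ext y
    exact (key y).2 (h y y.2)

end Syndrome

section Stabilizer

variable {d n : ℕ} [NeZero d]

/-- The operators `E_v`, `v ∈ L`, can be multiplied by phases so that they represent `L`. -/
theorem exists_phases (ψ : AddChar (ZMod d) ℂ) (L : AddSubgroup (Fin n → Alphabet d))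
    (hL : ∀ u ∈ L, ∀ v ∈ L, symp u v = 0) :
    ∃ c : L → ℂ, (∀ y, ‖c y‖ = 1) ∧
      ∀ y z : L, (c y • pauli ψ y.1) * (c z • pauli ψ z.1) = c (y + z) • pauli ψ (y + z).1 := by
  obtain ⟨φ, hφ, h⟩ := exists_common_eigenvector (E := (Fin n → ZMod d) → ℂ)
    (fun y : L => Matrix.toLin' (pauli ψ y.1)) (fun y z => by
      rw [commute_iff_eq, Module.End.mul_eq_comp, Module.End.mul_eq_comp, ← Matrix.toLin'_mul,
        ← Matrix.toLin'_mul, pauli_mul_comm, hL _ y.2 _ z.2, AddChar.map_zero_eq_one, one_smul])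
  choose e he using h
  simp only [Matrix.toLin'_apply] at he
  have hnorm (y : L) : ‖e y‖ = 1 := by
    have h1 := norm_mulVec_pauli ψ y.1 φ
    rw [he, star_smul, smul_dotProduct, dotProduct_smul, smul_smul, smul_eq_mul] at h1
    have h2 : star φ ⬝ᵥ φ ≠ 0 := fun h => hφ (dotProduct_star_self_eq_zero.1 h)
    have h3 : star (e y) * e y = 1 := mul_right_cancel₀ h2 (by rw [h1, one_mul])
    rw [RCLike.star_def, mul_comm, Complex.mul_conj, Complex.normSq_eq_norm_sq] at h3
    have h4 : ‖e y‖ ^ 2 = 1 := by exact_mod_cast h3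
    exact (pow_eq_one_iff_of_nonneg (norm_nonneg _) two_ne_zero).1 h4
  have hne (y : L) : e y ≠ 0 := fun h => by simpa [h] using hnorm y
  -- Dividing by the eigenvalues makes every operator fix `φ`. A product of two of them is a
  -- multiple of `E_{y+z}` that fixes `φ`, which determines its scalar.
  refine ⟨fun y => (e y)⁻¹, fun y => by simp [hnorm], fun y z => ?_⟩
  have h1 : (pauli ψ y.1 * pauli ψ z.1) *ᵥ φ = (e y * e z) • φ := by
    rw [← Matrix.mulVec_mulVec, he, Matrix.mulVec_smul, he, smul_smul, mul_comm]
  rw [pauli_mul, Matrix.smul_mulVec, ← AddSubgroup.coe_add, he, smul_smul] at h1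
  have h2 := smul_left_injective ℂ hφ h1
  rw [smul_mul_smul_comm, pauli_mul, ← AddSubgroup.coe_add, smul_smul]
  congr 1
  have := hne y; have := hne z; have := hne (y + z)
  field_simp
  linear_combination h2

/-- A representation of an isotropic group by multiples of the operators `E_v`. -/
structure PhasedRep (ψ : AddChar (ZMod d) ℂ) (L : AddSubgroup (Fin n → Alphabet d)) where
  phase : L → ℂ
  norm_phase : ∀ y, ‖phase y‖ = 1
  mul : ∀ y z : L, (phase y • pauli ψ y.1) * (phase z • pauli ψ z.1) =
    phase (y + z) • pauli ψ (y + z).1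

instance (L : AddSubgroup (Fin n → Alphabet d)) : Fintype L := Fintype.ofFinite L

namespace PhasedRep

variable {ψ : AddChar (ZMod d) ℂ} {L : AddSubgroup (Fin n → Alphabet d)} (N : PhasedRep ψ L)

/-- The operator representing `y`. -/
def op (y : L) : Op d n := N.phase y • pauli ψ y.1

theorem phase_ne_zero (y : L) : N.phase y ≠ 0 := fun h => by simpa [h] using N.norm_phase y

theorem op_mul (y z : L) : N.op y * N.op z = N.op (y + z) := N.mul y z

theorem conjTranspose_op_mul_self (y : L) : (N.op y)ᴴ * N.op y = 1 := by
  rw [op, Matrix.conjTranspose_smul, smul_mul_smul_comm, pauli_conjTranspose_mul_self,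
    RCLike.star_def, mul_comm, Complex.mul_conj, Complex.normSq_eq_norm_sq, N.norm_phase]
  simp

theorem op_zero : N.op 0 = 1 := by
  have h := N.op_mul 0 0
  rw [add_zero] at h
  rw [← one_mul (N.op 0), ← N.conjTranspose_op_mul_self 0, mul_assoc, h]

theorem conjTranspose_op (y : L) : (N.op y)ᴴ = N.op (-y) := by
  rw [← mul_one (N.op y)ᴴ, ← N.op_zero, ← add_neg_cancel y, ← N.op_mul, ← mul_assoc,
    N.conjTranspose_op_mul_self, one_mul]

/-- The projector onto the joint eigenspace with eigenvalues `χ`. -/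
def proj (χ : AddChar L ℂ) : Op d n := (Fintype.card L : ℂ)⁻¹ • ∑ y, χ (-y) • N.op y

theorem card_ne_zero : (Fintype.card L : ℂ) ≠ 0 := Nat.cast_ne_zero.2 Fintype.card_ne_zero

theorem op_mul_proj (χ : AddChar L ℂ) (y : L) : N.op y * N.proj χ = χ y • N.proj χ := by
  rw [proj, mul_smul_comm, smul_comm, Finset.mul_sum]
  congr 1
  rw [Finset.smul_sum]
  refine Fintype.sum_equiv (Equiv.addLeft y) _ _ fun z => ?_
  rw [mul_smul_comm, op_mul, Equiv.coe_addLeft, smul_smul, ← AddChar.map_add_eq_mul]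
  rw [neg_add, add_neg_cancel_left]

/-- Since `N.op y` acts on `N.proj χ` as `χ y`, the product is a multiple of `N.proj χ` whose
coefficient is given by orthogonality of characters. -/
theorem proj_mul_proj (χ τ : AddChar L ℂ) :
    N.proj τ * N.proj χ = if τ = χ then N.proj χ else 0 := by
  classical
  have h : N.proj τ * N.proj χ = ((Fintype.card L : ℂ)⁻¹ * ∑ y, (χ - τ) y) • N.proj χ := by
    conv_lhs => rw [proj]
    rw [smul_mul_assoc, mul_smul, Finset.sum_mul, Finset.sum_smul]
    congr 1
    refine Finset.sum_congr rfl fun y _ => ?_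
    rw [smul_mul_assoc, op_mul_proj, smul_smul, AddChar.sub_apply', AddChar.map_neg_eq_inv,
      div_eq_mul_inv, mul_comm]
  rw [h, AddChar.sum_eq_ite]
  by_cases hx : τ = χ
  · simp [hx]
  · rw [if_neg hx, if_neg (fun h0 => hx (sub_eq_zero.1 h0).symm)]; simp

theorem proj_mul_self (χ : AddChar L ℂ) : N.proj χ * N.proj χ = N.proj χ := by
  rw [proj_mul_proj, if_pos rfl]

theorem conjTranspose_proj (χ : AddChar L ℂ) : (N.proj χ)ᴴ = N.proj χ := by
  rw [proj, Matrix.conjTranspose_smul, Matrix.conjTranspose_sum]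
  congr 1
  · simp
  · refine Fintype.sum_equiv (Equiv.neg L) _ _ fun y => ?_
    rw [Matrix.conjTranspose_smul, conjTranspose_op, Equiv.neg_apply, RCLike.star_def,
      ← AddChar.map_neg_eq_conj]

theorem sum_proj : ∑ χ, N.proj χ = 1 := by
  classical
  simp only [proj]
  rw [← Finset.smul_sum, Finset.sum_comm]
  have h (y : L) : ∑ χ : AddChar L ℂ, χ (-y) • N.op y =
      if y = 0 then (Fintype.card L : ℂ) • N.op y else 0 := by
    rw [← Finset.sum_smul, AddChar.sum_apply_eq_ite]
    split_ifs with h1 h2 h2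
    · rfl
    · exact absurd (neg_eq_zero.1 h1) h2
    · exact absurd (neg_eq_zero.2 h2) h1
    · rw [zero_smul]
  rw [Finset.sum_congr rfl fun y _ => h y, Finset.sum_ite_eq' Finset.univ (0 : L),
    if_pos (Finset.mem_univ _), op_zero, smul_smul, inv_mul_cancel₀ card_ne_zero, one_smul]

end PhasedRep

section

variable {ψ : AddChar (ZMod d) ℂ} {L : AddSubgroup (Fin n → Alphabet d)}

namespace PhasedRep

variable (N : PhasedRep ψ L)

/-- Moving `E_v` past `E_y` costs the phase `ψ (symp y v)`, which twists the character. This is what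
makes the syndrome measurable. -/
theorem pauli_mul_proj (χ : AddChar L ℂ) (v : Fin n → Alphabet d) :
    pauli ψ v * N.proj χ = N.proj (χ + syndrome ψ L v) * pauli ψ v := by
  rw [proj, proj, mul_smul_comm, smul_mul_assoc, Finset.mul_sum, Finset.sum_mul]
  congr 1
  refine Finset.sum_congr rfl fun y _ => ?_
  rw [op, mul_smul_comm, mul_smul_comm, smul_mul_assoc, smul_mul_assoc, pauli_mul_comm,
    AddChar.add_apply, syndrome_apply, AddSubgroup.coe_neg, symp_neg_left, ← symp_swap, smul_smul,
    smul_smul, smul_smul, mul_right_comm]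

theorem conjTranspose_pauli_mul_proj (χ : AddChar L ℂ) (v : Fin n → Alphabet d) :
    (pauli ψ v)ᴴ * N.proj (χ + syndrome ψ L v) = N.proj χ * (pauli ψ v)ᴴ := by
  have := congrArg Matrix.conjTranspose (N.pauli_mul_proj χ v)
  simpa only [Matrix.conjTranspose_mul, conjTranspose_proj] using this.symm

variable [Fact d.Prime]

/-- The projector is a combination of `E_y` with `y ∈ L`, so the product has no component along the
identity. -/
theorem trace_proj_mul_pauli (hψ : ∀ a, ψ a = 1 → a = 0) (χ : AddChar L ℂ)
    {v : Fin n → Alphabet d} (hv : v ∉ L) : (N.proj χ * pauli ψ v).trace = 0 := by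
  rw [proj, smul_mul_assoc, Finset.sum_mul, Matrix.trace_smul, Matrix.trace_sum,
    Finset.sum_eq_zero, smul_zero]
  intro y _
  have : y.1 + v ≠ 0 := fun h => hv (by rw [← neg_eq_of_add_eq_zero_right h]; exact neg_mem y.2)
  rw [op, smul_mul_assoc, smul_mul_assoc, pauli_mul, Matrix.trace_smul, Matrix.trace_smul,
    Matrix.trace_smul, trace_pauli ψ hψ this]
  simp

theorem trace_proj (hψ : ∀ a, ψ a = 1 → a = 0) (χ : AddChar L ℂ) :
    (N.proj χ).trace = (Fintype.card L : ℂ)⁻¹ * d ^ n := by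
  rw [proj, Matrix.trace_smul, Matrix.trace_sum, Finset.sum_eq_single 0]
  · rw [op_zero, neg_zero, AddChar.map_zero_eq_one, one_smul, Matrix.trace_one]
    simp [ZMod.card]
  · intro y _ hy
    rw [op, Matrix.trace_smul, Matrix.trace_smul,
      trace_pauli ψ hψ (fun h => hy (Subtype.ext h))]
    simp
  · simp

theorem trace_proj_ne_zero (hψ : ∀ a, ψ a = 1 → a = 0) (χ : AddChar L ℂ) :
    (N.proj χ).trace ≠ 0 := by
  rw [N.trace_proj hψ]
  exact mul_ne_zero (inv_ne_zero card_ne_zero)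
    (pow_ne_zero _ (Nat.cast_ne_zero.2 (NeZero.ne d)))

end PhasedRep

end

end Stabilizer

/-! ### Syndrome decoding and averaging over the eigenspaces -/

section Decoding

/-- Parseval. Applied to `L`, it removes the interference between errors of one coset. -/
theorem sum_norm_sq_fourier {A : Type*} [AddCommGroup A] [Fintype A] (f : A → ℂ) :
    ∑ χ : AddChar A ℂ, ‖∑ y, f y * χ y‖ ^ 2 = Fintype.card A * ∑ y, ‖f y‖ ^ 2 := by
  classical
  have h : ((∑ χ : AddChar A ℂ, ‖∑ y, f y * χ y‖ ^ 2 : ℝ) : ℂ) =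
      ((Fintype.card A * ∑ y, ‖f y‖ ^ 2 : ℝ) : ℂ) := by
    push_cast
    have key (χ : AddChar A ℂ) : ((‖∑ y, f y * χ y‖ : ℝ) : ℂ) ^ 2 =
        ∑ y, ∑ z, f y * (starRingEnd ℂ) (f z) * χ (y - z) := by
      rw [← Complex.mul_conj', map_sum, Finset.sum_mul_sum]
      refine Finset.sum_congr rfl fun y _ => Finset.sum_congr rfl fun z _ => ?_
      rw [map_mul, ← AddChar.map_neg_eq_conj, sub_eq_add_neg, AddChar.map_add_eq_mul]
      ring
    rw [Finset.sum_congr rfl fun χ _ => key χ, Finset.sum_comm, Finset.mul_sum]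
    refine Finset.sum_congr rfl fun y _ => ?_
    rw [Finset.sum_comm, Finset.sum_eq_single y]
    · rw [← Finset.mul_sum, AddChar.sum_apply_eq_ite, if_pos (sub_self y), Complex.mul_conj']
      ring
    · intro z _ hz
      rw [← Finset.mul_sum, AddChar.sum_apply_eq_ite, if_neg (fun h => hz (sub_eq_zero.1 h).symm),
        mul_zero]
    · simp
  exact_mod_cast h

variable {d n : ℕ} [NeZero d]
variable {ψ : AddChar (ZMod d) ℂ} {L : AddSubgroup (Fin n → Alphabet d)}

namespace PhasedRep

variable (N : PhasedRep ψ L)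

/-- The Kraus operators of the recovery for the code with projector `N.proj χ`, which corrects the
error `r τ` when the syndrome is `τ`. -/
def recovery (r : AddChar L ℂ → Fin n → Alphabet d) (χ τ : AddChar L ℂ) : Op d n :=
  (pauli ψ (r τ))ᴴ * N.proj (χ + τ)

theorem sum_recovery (r : AddChar L ℂ → Fin n → Alphabet d) (χ : AddChar L ℂ) :
    ∑ τ, (N.recovery r χ τ)ᴴ * N.recovery r χ τ = 1 := by
  have (τ : AddChar L ℂ) : (N.recovery r χ τ)ᴴ * N.recovery r χ τ = N.proj (χ + τ) := by
    rw [recovery, Matrix.conjTranspose_mul, Matrix.conjTranspose_conjTranspose, mul_assoc,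
      ← mul_assoc (pauli ψ (r τ)), pauli_mul_conjTranspose_self, one_mul, conjTranspose_proj,
      proj_mul_self]
  rw [Finset.sum_congr rfl fun τ _ => this τ, ← N.sum_proj]
  exact Fintype.sum_equiv (Equiv.addLeft χ) _ _ fun τ => rfl

/-- The phase relating `E_v^* E_{v + y}` to the operator representing `y`. -/
def shiftPhase (v : Fin n → Alphabet d) (y : L) : ℂ :=
  ψ (-∑ i, (v i).2 * (v i).1) * ψ (-∑ i, ((-v) i).2 * ((v + y.1) i).1) * (N.phase y)⁻¹

theorem norm_shiftPhase (v : Fin n → Alphabet d) (y : L) : ‖N.shiftPhase v y‖ = 1 := by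
  rw [shiftPhase, norm_mul, norm_mul, norm_inv, N.norm_phase, AddChar.norm_apply,
    AddChar.norm_apply]
  simp

theorem conjTranspose_pauli_mul (u v : Fin n → Alphabet d) :
    (pauli ψ u)ᴴ * pauli ψ v =
      (ψ (-∑ i, (u i).2 * (u i).1) * ψ (-∑ i, ((-u) i).2 * (v i).1)) • pauli ψ (v - u) := by
  rw [pauli_conjTranspose, smul_mul_assoc, pauli_mul, smul_smul, neg_add_eq_sub]

/-- Only `v ∈ u + L` contribute. For `v = u + y` the operator `E_u^* E_v` is a phase times `N.op y`,
which acts on the code as `χ y`; so the trace is a Fourier sum over `L`. -/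
theorem trace_proj_mul_kraus_term [Fact d.Prime] (hψ : ∀ a, ψ a = 1 → a = 0) (χ : AddChar L ℂ)
    (u : Fin n → Alphabet d) (a : (Fin n → Alphabet d) → ℂ) :
    (N.proj χ * ((pauli ψ u)ᴴ * ∑ v, a v • pauli ψ v)).trace =
      (∑ y : L, a (u + y.1) * N.shiftPhase u y * χ y) * (N.proj χ).trace := by
  classical
  rw [Finset.mul_sum, Finset.mul_sum, Matrix.trace_sum, Finset.sum_mul]
  have h0 (v : Fin n → Alphabet d) (hv : v ∉ Finset.univ.map
      ((Function.Embedding.subtype (· ∈ L)).trans (Equiv.addLeft u).toEmbedding)) :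
      (N.proj χ * ((pauli ψ u)ᴴ * a v • pauli ψ v)).trace = 0 := by
    have hv' : v - u ∉ L := fun h => hv (Finset.mem_map.2 ⟨⟨v - u, h⟩, Finset.mem_univ _, by
      simp⟩)
    rw [mul_smul_comm, conjTranspose_pauli_mul, mul_smul_comm, mul_smul_comm, Matrix.trace_smul,
      Matrix.trace_smul, N.trace_proj_mul_pauli hψ χ hv', smul_zero, smul_zero]
  rw [← Finset.sum_subset (Finset.subset_univ _) fun v _ hv => h0 v hv, Finset.sum_map]
  refine Finset.sum_congr rfl fun y _ => ?_
  simp only [Function.Embedding.trans_apply, Function.Embedding.subtype_apply,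
    Equiv.coe_toEmbedding, Equiv.coe_addLeft]
  have hy : pauli ψ y.1 = (N.phase y)⁻¹ • N.op y := by
    rw [op, smul_smul, inv_mul_cancel₀ (N.phase_ne_zero y), one_smul]
  rw [mul_smul_comm, conjTranspose_pauli_mul, add_sub_cancel_left, hy, mul_smul_comm,
    mul_smul_comm, mul_smul_comm, Matrix.trace_smul, Matrix.trace_smul, Matrix.trace_smul,
    Matrix.trace_mul_comm, op_mul_proj, Matrix.trace_smul, shiftPhase]
  simp only [smul_eq_mul]
  ring

theorem trace_proj_mul_recovery [Fact d.Prime] (hψ : ∀ a, ψ a = 1 → a = 0)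
    {r : AddChar L ℂ → Fin n → Alphabet d} (χ : AddChar L ℂ) {τ : AddChar L ℂ}
    (hτ : syndrome ψ L (r τ) = τ) (a : (Fin n → Alphabet d) → ℂ) :
    (N.proj χ * (N.recovery r χ τ * ∑ v, a v • pauli ψ v)).trace =
      (∑ y : L, a (r τ + y.1) * N.shiftPhase (r τ) y * χ y) * (N.proj χ).trace := by
  rw [← N.trace_proj_mul_kraus_term hψ, recovery]
  have := N.conjTranspose_pauli_mul_proj χ (r τ)
  rw [hτ] at this
  rw [this, mul_assoc, ← mul_assoc, proj_mul_self]

end PhasedRep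

theorem eq_zero_of_zmodChar_eq_one {ω : ℂ} (hω : IsPrimitiveRoot ω d) {a : ZMod d}
    (ha : AddChar.zmodChar d hω.pow_eq_one a = 1) : a = 0 := by
  rw [AddChar.zmodChar_apply] at ha
  have := hω.dvd_of_pow_eq_one _ ha
  rwa [← ZMod.natCast_eq_zero_iff, ZMod.natCast_zmod_val] at this

/-- Some code stabilized by an isotropic group `L`, decoded with the coset leaders `r`, has fidelity
at least the probability of the set of errors corrected by `r` up to `L`. -/
theorem exists_code [Fact d.Prime] {ω : ℂ} (hω : IsPrimitiveRoot ω d) (W : QDMC d)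
    (hL : ∀ u ∈ L, ∀ v ∈ L, symp u v = 0)
    (r : AddChar L ℂ → Fin n → Alphabet d)
    (hr : ∀ v, syndrome (AddChar.zmodChar d hω.pow_eq_one) L
      (r (syndrome (AddChar.zmodChar d hω.pow_eq_one) L v)) =
        syndrome (AddChar.zmodChar d hω.pow_eq_one) L v) (Γ : Finset (Fin n → Alphabet d))
    (hΓ : ∀ v ∈ Γ, v - r (syndrome (AddChar.zmodChar d hω.pow_eq_one) L v) ∈ L) :
    ∃ (Q : Submodule ℂ (Space d n)) (Rec : Op d n →ₗ[ℂ] Op d n), IsCPTP Rec ∧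
      Module.finrank ℂ Q * Fintype.card L = d ^ n ∧
      ∑ v ∈ Γ, W.probPow v ≤ fidelity ω W Q Rec := by
  classical
  set ψ := AddChar.zmodChar d hω.pow_eq_one with hψdef
  have hψ : ∀ a, ψ a = 1 → a = 0 := fun a => eq_zero_of_zmodChar_eq_one hω
  obtain ⟨c, hc, hc'⟩ := exists_phases ψ L hL
  let N : PhasedRep ψ L := ⟨c, hc, hc'⟩
  -- Syndromes whose leader is not consistent are dropped; their contributions to the fidelity bound
  -- are nonnegative.
  set T : Finset (AddChar L ℂ) := Finset.univ.filter fun τ => syndrome ψ L (r τ) = τ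
  have hfid (χ : AddChar L ℂ) :
      ∑ τ ∈ T, ∑ u, ‖∑ y : L, W.coeffPow u (r τ + y.1) * N.shiftPhase (r τ) y * χ y‖ ^ 2 ≤
        fidelity ω W (rangeOf (N.proj χ)) (krausMap (N.recovery r χ)) := by
    refine le_trans ?_ (le_fidelity ω W (N.proj_mul_self χ) (N.conjTranspose_proj χ) _)
    refine le_trans (Finset.sum_le_sum fun τ hτ => Finset.sum_le_sum fun u _ => ?_)
      (Finset.sum_le_univ_sum_of_nonneg (s := T) fun τ => Finset.sum_nonneg fun u _ => by positivity)
    rw [QDMC.krausPow_eq hω.pow_eq_one, ← hψdef,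
      N.trace_proj_mul_recovery hψ χ (Finset.mem_filter.1 hτ).2, norm_mul, mul_pow,
      mul_div_cancel_right₀]
    exact pow_ne_zero _ (norm_ne_zero_iff.2 (N.trace_proj_ne_zero hψ χ))
  have hsum : ∑ χ : AddChar L ℂ, ∑ τ ∈ T, ∑ u,
      ‖∑ y : L, W.coeffPow u (r τ + y.1) * N.shiftPhase (r τ) y * χ y‖ ^ 2 =
      Fintype.card L * ∑ τ ∈ T, ∑ y : L, W.probPow (r τ + y.1) := by
    rw [Finset.sum_comm, Finset.mul_sum]
    refine Finset.sum_congr rfl fun τ _ => ?_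
    rw [Finset.sum_comm]
    simp only [sum_norm_sq_fourier, norm_mul, N.norm_shiftPhase, mul_one]
    rw [← Finset.mul_sum, Finset.sum_comm]
    simp only [QDMC.sum_coeffPow]
  have hΓle : ∑ v ∈ Γ, W.probPow v ≤ ∑ τ ∈ T, ∑ y : L, W.probPow (r τ + y.1) := by
    have hmaps : ∀ v ∈ Γ, syndrome ψ L v ∈ T := fun v _ =>
      Finset.mem_filter.2 ⟨Finset.mem_univ _, hr v⟩
    rw [← Finset.sum_fiberwise_of_maps_to hmaps]
    refine Finset.sum_le_sum fun τ _ => ?_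
    have : ∑ y : L, W.probPow (r τ + y.1) = ∑ v ∈ Finset.univ.map
        ((Function.Embedding.subtype (· ∈ L)).trans (Equiv.addLeft (r τ)).toEmbedding),
        W.probPow v := by
      rw [Finset.sum_map]; rfl
    rw [this]
    refine Finset.sum_le_sum_of_subset_of_nonneg (fun v hv => ?_) fun _ _ _ => W.probPow_nonneg _
    obtain ⟨hvΓ, rfl⟩ := Finset.mem_filter.1 hv
    exact Finset.mem_map.2 ⟨⟨_, hΓ v hvΓ⟩, Finset.mem_univ _, by simp⟩
  have hcard : (Fintype.card (AddChar L ℂ) : ℝ) = Fintype.card L := by rw [AddChar.card_eq]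
  -- There are as many characters as elements of `L`, so the factor from Parseval is exactly that of
  -- averaging over `χ`.
  obtain ⟨χ, -, hχ⟩ := Finset.exists_le_of_sum_le (s := (Finset.univ : Finset (AddChar L ℂ)))
    (f := fun _ => ∑ v ∈ Γ, W.probPow v) (g := fun χ => ∑ τ ∈ T, ∑ u,
      ‖∑ y : L, W.coeffPow u (r τ + y.1) * N.shiftPhase (r τ) y * χ y‖ ^ 2) ⟨0, Finset.mem_univ _⟩
    (by
      rw [hsum, Finset.sum_const, nsmul_eq_mul, Finset.card_univ, hcard]
      exact mul_le_mul_of_nonneg_left hΓle (Nat.cast_nonneg _))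
  refine ⟨rangeOf (N.proj χ), krausMap (N.recovery r χ), isCPTP_krausMap _ (N.sum_recovery r χ), ?_,
    hχ.trans (hfid χ)⟩
  have h := finrank_rangeOf (N.proj_mul_self χ) (N.conjTranspose_proj χ)
  rw [N.trace_proj hψ, inv_mul_eq_div, eq_div_iff PhasedRep.card_ne_zero] at h
  exact_mod_cast h

end Decoding

/-! ### Random isotropic groups -/

section Transitivity

variable {d n : ℕ}

/-- The group of additive permutations of `𝒳 ^ n` preserving the symplectic form. -/
def sympGroup (d n : ℕ) : Subgroup (Equiv.Perm (Fin n → Alphabet d)) where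
  carrier := {g | (∀ u v, g (u + v) = g u + g v) ∧ ∀ u v, symp (g u) (g v) = symp u v}
  mul_mem' := fun {g h} hg hh => ⟨fun u v => by simp [hh.1, hg.1], fun u v => by simp [hh.2, hg.2]⟩
  one_mem' := ⟨fun _ _ => rfl, fun _ _ => rfl⟩
  inv_mem' := fun {g} hg => ⟨fun u v => g.injective (by simp [hg.1]), fun u v => by
    rw [← hg.2]; simp⟩

theorem perm_apply_inv {α : Type*} (g : Equiv.Perm α) (x : α) : g (g⁻¹ x) = x :=
  g.apply_symm_apply x

theorem mem_sympGroup {g : Equiv.Perm (Fin n → Alphabet d)} : g ∈ sympGroup d n ↔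
    (∀ u v, g (u + v) = g u + g v) ∧ ∀ u v, symp (g u) (g v) = symp u v := Iff.rfl

/-- The transvection `v ↦ v + c ⟨v, w⟩ w`. -/
def transvection (c : ZMod d) (w : Fin n → Alphabet d) : Equiv.Perm (Fin n → Alphabet d) where
  toFun v := v + (c * symp v w) • w
  invFun v := v - (c * symp v w) • w
  left_inv v := by
    simp only [symp_add_left, symp_smul_left, symp_self, mul_zero, add_zero, add_sub_cancel_right]
  right_inv v := by
    simp only [symp_sub_left, symp_smul_left, symp_self, mul_zero, sub_zero, sub_add_cancel]

theorem transvection_apply (c : ZMod d) (w v : Fin n → Alphabet d) :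
    transvection c w v = v + (c * symp v w) • w := rfl

theorem transvection_mem (c : ZMod d) (w : Fin n → Alphabet d) :
    transvection c w ∈ sympGroup d n := by
  refine mem_sympGroup.2 ⟨fun u v => ?_, fun u v => ?_⟩
  · simp only [transvection_apply, symp_add_left, mul_add, add_smul]
    abel
  · simp only [transvection_apply, symp_add_left, symp_add_right, symp_smul_left, symp_smul_right,
      symp_self, symp_swap w v]
    ring

variable [Fact d.Prime]

/-- One transvection along `v - u` suffices, scaled so that `u` moves by exactly `v - u`. -/
theorem exists_sympGroup_of_symp_ne_zero {u v : Fin n → Alphabet d} (h : symp u v ≠ 0) :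
    ∃ g ∈ sympGroup d n, g u = v := by
  refine ⟨transvection (symp u v)⁻¹ (v - u), transvection_mem _ _, ?_⟩
  have : symp u (v - u) = symp u v := by
    rw [symp_swap, symp_sub_left, symp_self, sub_zero, ← symp_swap]
  rw [transvection_apply, this, inv_mul_cancel₀ h, one_smul, add_sub_cancel]

/-- Transitivity goes through an intermediate `w` orthogonal to neither vector; such `w` exists
because two proper subgroups never cover a group. -/
theorem exists_sympGroup_apply_eq {u v : Fin n → Alphabet d} (hu : u ≠ 0) (hv : v ≠ 0) :
    ∃ g ∈ sympGroup d n, g u = v := by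
  suffices ∃ w, symp u w ≠ 0 ∧ symp v w ≠ 0 by
    obtain ⟨w, h1, h2⟩ := this
    obtain ⟨g, hg, hgu⟩ := exists_sympGroup_of_symp_ne_zero h1
    obtain ⟨h, hh, hhw⟩ := exists_sympGroup_of_symp_ne_zero
      (show symp w v ≠ 0 by rw [symp_swap]; exact neg_ne_zero.2 h2)
    exact ⟨h * g, mul_mem hh hg, by simp [hgu, hhw]⟩
  obtain ⟨w₁, h₁⟩ := exists_symp_ne_zero hu
  obtain ⟨w₂, h₂⟩ := exists_symp_ne_zero hv
  by_cases h₃ : symp v w₁ = 0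
  · by_cases h₄ : symp u w₂ = 0
    · refine ⟨w₁ + w₂, ?_, ?_⟩
      · rwa [symp_add_right, h₄, add_zero]
      · rwa [symp_add_right, h₃, zero_add]
    · exact ⟨w₂, h₄, h₂⟩
  · exact ⟨w₁, h₁, h₃⟩

open Classical in
theorem card_filter_sympGroup_eq (A : Finset (Fin n → Alphabet d)) {u v : Fin n → Alphabet d}
    (hu : u ≠ 0) (hv : v ≠ 0) :
    (Finset.univ.filter fun g : sympGroup d n => g.1⁻¹ u ∈ A).card =
      (Finset.univ.filter fun g : sympGroup d n => g.1⁻¹ v ∈ A).card := by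
  obtain ⟨h, hh, rfl⟩ := exists_sympGroup_apply_eq hu hv
  refine Finset.card_equiv (Equiv.mulLeft ⟨h, hh⟩) fun g => ?_
  have e : (h * g.1)⁻¹ (h u) = g.1⁻¹ u := congrArg g.1.symm (h.symm_apply_apply u)
  rw [Finset.mem_filter, Finset.mem_filter, Equiv.coe_mulLeft, Subgroup.coe_mul, e]
  simp only [Finset.mem_univ, true_and]

-- Double counting of pairs `(g, v)` with `v ≠ 0` and `g⁻¹ v ∈ A`: each `g` contributes `A.card`,
-- and by transitivity each `v` contributes equally.
open Classical in
theorem card_filter_sympGroup_mul (A : Finset (Fin n → Alphabet d)) (h0 : 0 ∉ A)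
    {u : Fin n → Alphabet d} (hu : u ≠ 0) :
    (Finset.univ.filter fun g : sympGroup d n => g.1⁻¹ u ∈ A).card * (d ^ (2 * n) - 1) =
      Fintype.card (sympGroup d n) * A.card := by
  have hV : (Finset.univ.erase (0 : Fin n → Alphabet d)).card = d ^ (2 * n) - 1 := by
    rw [Finset.card_erase_of_mem (Finset.mem_univ _), Finset.card_univ]
    simp [ZMod.card, ← pow_two, ← pow_mul]
  rw [mul_comm, ← hV, ← smul_eq_mul, ← Finset.sum_const]
  have h1 : ∑ _v ∈ Finset.univ.erase (0 : Fin n → Alphabet d),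
      (Finset.univ.filter fun g : sympGroup d n => g.1⁻¹ u ∈ A).card =
      ∑ v ∈ Finset.univ.erase (0 : Fin n → Alphabet d), ∑ g : sympGroup d n,
        if g.1⁻¹ v ∈ A then 1 else 0 := by
    refine Finset.sum_congr rfl fun v hv => ?_
    rw [card_filter_sympGroup_eq A hu (Finset.ne_of_mem_erase hv), Finset.card_filter]
  rw [h1, Finset.sum_comm, ← smul_eq_mul, Fintype.card, ← Finset.sum_const]
  refine Finset.sum_congr rfl fun g _ => ?_
  rw [← Finset.card_filter]
  refine Finset.card_equiv g.1⁻¹ fun v => ?_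
  have hg0 : g.1⁻¹ 0 = 0 := by
    have := (mem_sympGroup.1 (inv_mem g.2)).1 0 0
    simpa using this
  simp only [Finset.mem_filter, Finset.mem_erase, Finset.mem_univ, and_true]
  refine ⟨fun h => h.2, fun h => ⟨?_, h⟩⟩
  rintro rfl
  rw [hg0] at h
  exact h0 h

end Transitivity

/-! ### Isotropic groups and their symplectic images -/

section Isotropic

variable {d n : ℕ}

/-- The vectors orthogonal to `L`. -/
def orth (L : AddSubgroup (Fin n → Alphabet d)) : Set (Fin n → Alphabet d) :=
  {v | ∀ y ∈ L, symp v y = 0}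

/-- The standard isotropic group with `d ^ m` elements. -/
def stdIsotropic (d n m : ℕ) : AddSubgroup (Fin n → Alphabet d) where
  carrier := {v | ∀ i, (v i).1 = 0 ∧ (m ≤ i.val → (v i).2 = 0)}
  add_mem' := fun {u v} hu hv i => ⟨by simp [(hu i).1, (hv i).1], fun hi => by
    simp [(hu i).2 hi, (hv i).2 hi]⟩
  zero_mem' := fun i => ⟨rfl, fun _ => rfl⟩
  neg_mem' := fun {u} hu i => ⟨by simp [(hu i).1], fun hi => by simp [(hu i).2 hi]⟩

theorem stdIsotropic_isotropic (m : ℕ) :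
    ∀ u ∈ stdIsotropic d n m, ∀ v ∈ stdIsotropic d n m, symp u v = 0 := fun u hu v hv =>
  Finset.sum_eq_zero fun i _ => by rw [(hu i).1, (hv i).1]; ring

theorem card_pi_fin_ite {m : ℕ} (hm : m ≤ n) (a b : ℕ) :
    ∏ i : Fin n, (if i.val < m then a else b) = a ^ m * b ^ (n - m) := by
  rw [Fin.prod_univ_eq_prod_range (fun i => if i < m then a else b),
    ← Finset.prod_range_mul_prod_Ico _ hm]
  congr 1
  · rw [Finset.prod_congr rfl fun i hi => if_pos (Finset.mem_range.1 hi)]; simp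
  · rw [Finset.prod_congr rfl fun i hi => if_neg (not_lt.2 (Finset.mem_Ico.1 hi).1)]; simp

theorem card_stdIsotropic [NeZero d] {m : ℕ} (hm : m ≤ n) :
    Nat.card (stdIsotropic d n m) = d ^ m := by
  classical
  let e : stdIsotropic d n m ≃ {v : Fin n → Alphabet d // v ∈ Fintype.piFinset fun i : Fin n =>
      (if i.val < m then {0} ×ˢ Finset.univ else {(0, 0)} : Finset (Alphabet d))} :=
    Equiv.subtypeEquivRight fun v => by
      rw [Fintype.mem_piFinset]
      refine forall_congr' fun i => ?_
      split_ifs with hi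
      · rw [Finset.mem_product]; simp [not_le.2 hi]
      · simp [not_lt.1 hi, Prod.ext_iff]
  rw [Nat.card_congr e, Nat.card_eq_fintype_card, Fintype.card_coe, Fintype.card_piFinset]
  calc _ = ∏ i : Fin n, (if i.val < m then d else 1) := by
        refine Finset.prod_congr rfl fun i _ => ?_
        split_ifs <;> simp [ZMod.card]
    _ = d ^ m := by rw [card_pi_fin_ite hm]; simp

-- Pairing with `(0, 1)` at a position below `m` kills the first component there, leaving `d`
-- choices instead of `d ^ 2`.
open Classical in
theorem card_orth_stdIsotropic_le [Fact d.Prime] {m : ℕ} (hm : m ≤ n) :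
    (Finset.univ.filter fun v => v ∈ orth (stdIsotropic d n m)).card ≤ d ^ (2 * n - m) := by
  have hsub : (Finset.univ.filter fun v => v ∈ orth (stdIsotropic d n m)) ⊆
      Fintype.piFinset fun i : Fin n =>
        (if i.val < m then {0} ×ˢ Finset.univ else Finset.univ : Finset (Alphabet d)) := by
    intro v hv
    rw [Fintype.mem_piFinset]
    intro i
    split_ifs with hi
    · have h1 := (Finset.mem_filter.1 hv).2 (Pi.single i (0, 1)) (fun j => by
        rcases eq_or_ne j i with rfl | hj
        · simp [not_le.2 hi]
        · simp [Pi.single_eq_of_ne hj])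
      have h2 : symp v (Pi.single i ((0, 1) : Alphabet d)) = (v i).1 := by
        rw [symp, Finset.sum_eq_single i]
        · simp
        · intro j _ hj; simp [Pi.single_eq_of_ne hj]
        · simp
      rw [h2] at h1
      rw [Finset.mem_product]; simp [h1]
    · simp
  refine (Finset.card_le_card hsub).trans (le_of_eq ?_)
  rw [Fintype.card_piFinset]
  calc _ = ∏ i : Fin n, (if i.val < m then d else d ^ 2) := by
        refine Finset.prod_congr rfl fun i _ => ?_
        split_ifs <;> simp [ZMod.card, pow_two]
    _ = d ^ (2 * n - m) := by
        rw [card_pi_fin_ite hm, ← pow_mul, ← pow_add]; congr 1; omega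

/-- The image of a group under a symplectic permutation. -/
def sympImage (L : AddSubgroup (Fin n → Alphabet d)) (g : sympGroup d n) :
    AddSubgroup (Fin n → Alphabet d) where
  carrier := {v | g.1⁻¹ v ∈ L}
  add_mem' := fun {u v} hu hv => by
    simp only [Set.mem_ofPred_eq, (mem_sympGroup.1 (inv_mem g.2)).1]; exact add_mem hu hv
  zero_mem' := by
    have h : g.1⁻¹ 0 = 0 := by simpa using (mem_sympGroup.1 (inv_mem g.2)).1 0 0
    simp only [Set.mem_ofPred_eq, h]; exact zero_mem L
  neg_mem' := fun {u} hu => by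
    have h : g.1⁻¹ (-u) = -g.1⁻¹ u := by
      have h0 : g.1⁻¹ 0 = 0 := by simpa using (mem_sympGroup.1 (inv_mem g.2)).1 0 0
      have h1 := (mem_sympGroup.1 (inv_mem g.2)).1 u (-u)
      rw [add_neg_cancel, h0] at h1
      exact (neg_eq_of_add_eq_zero_right h1.symm).symm
    simp only [Set.mem_ofPred_eq, h]; exact neg_mem hu

theorem mem_sympImage {L : AddSubgroup (Fin n → Alphabet d)} {g : sympGroup d n}
    {v : Fin n → Alphabet d} : v ∈ sympImage L g ↔ g.1⁻¹ v ∈ L := Iff.rfl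

theorem mem_orth_sympImage {L : AddSubgroup (Fin n → Alphabet d)} {g : sympGroup d n}
    {v : Fin n → Alphabet d} : v ∈ orth (sympImage L g) ↔ g.1⁻¹ v ∈ orth L := by
  constructor
  · intro h y hy
    rw [← (mem_sympGroup.1 g.2).2, perm_apply_inv]
    exact h _ (mem_sympImage.2 (by simpa using hy))
  · intro h y hy
    rw [← (mem_sympGroup.1 (inv_mem g.2)).2]
    exact h _ hy

theorem card_sympImage (L : AddSubgroup (Fin n → Alphabet d)) (g : sympGroup d n) :
    Nat.card (sympImage L g) = Nat.card L :=
  Nat.card_congr (Equiv.subtypeEquiv g.1⁻¹ fun _ => Iff.rfl)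

open Classical in
/-- For a random symplectic image of the standard isotropic group, a nonzero vector is orthogonal to
it with probability at most `d ^ (-m)`. -/
theorem card_filter_mem_orth_le [Fact d.Prime] {m : ℕ} (hm : m ≤ n) {u : Fin n → Alphabet d}
    (hu : u ≠ 0) :
    (Finset.univ.filter fun g : sympGroup d n => u ∈ orth (sympImage (stdIsotropic d n m) g)).card *
      d ^ m ≤ Fintype.card (sympGroup d n) := by
  set A := (Finset.univ.filter fun v => v ∈ orth (stdIsotropic d n m)).erase 0 with hA
  set c := (Finset.univ.filter fun g : sympGroup d n =>
    u ∈ orth (sympImage (stdIsotropic d n m) g)).card with hc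
  have h0 : (0 : Fin n → Alphabet d) ∈
      Finset.univ.filter fun v => v ∈ orth (stdIsotropic d n m) :=
    Finset.mem_filter.2 ⟨Finset.mem_univ _, fun y _ => symp_zero_left y⟩
  have h1 : c * (d ^ (2 * n) - 1) = Fintype.card (sympGroup d n) * A.card := by
    rw [← card_filter_sympGroup_mul A (Finset.notMem_erase _ _) hu, hc]
    congr 2
    refine Finset.filter_congr fun g _ => ?_
    rw [mem_orth_sympImage, hA, Finset.mem_erase, Finset.mem_filter]
    refine ⟨fun h => ⟨fun h2 => hu ?_, Finset.mem_univ _, h⟩, fun h => h.2.2⟩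
    have h3 : g.1 0 = 0 := by simpa using (mem_sympGroup.1 g.2).1 0 0
    rw [← h3, ← h2, perm_apply_inv]
  have hA' : A.card ≤ d ^ (2 * n - m) - 1 := by
    rw [hA, Finset.card_erase_of_mem h0]
    exact Nat.sub_le_sub_right (card_orth_stdIsotropic_le hm) 1
  have hd : 1 < d := (Fact.out : d.Prime).one_lt
  have hn : 0 < n := Nat.pos_of_ne_zero fun h => hu (by subst h; exact Subsingleton.elim _ _)
  have hpos : 0 < d ^ (2 * n) - 1 := Nat.sub_pos_of_lt (Nat.one_lt_pow (by omega) hd)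
  refine Nat.le_of_mul_le_mul_right ?_ hpos
  calc c * d ^ m * (d ^ (2 * n) - 1) = Fintype.card (sympGroup d n) * (A.card * d ^ m) := by
        rw [mul_right_comm, h1, mul_assoc]
    _ ≤ Fintype.card (sympGroup d n) * (d ^ (2 * n) - 1) := by
        -- Removing the zero vector only helps: `(d ^ (2n - m) - 1) d ^ m = d ^ (2n) - d ^ m ≤ d ^
        -- (2n) - 1`.
        refine Nat.mul_le_mul_left _ ((Nat.mul_le_mul_right _ hA').trans ?_)
        rw [Nat.sub_mul, ← pow_add, one_mul, Nat.sub_add_cancel (by omega)]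
        exact Nat.sub_le_sub_left (Nat.one_le_pow _ _ (by omega)) _

open Classical in
/-- There is an isotropic group for which few errors `x` are confused with an error of cost at most
the cost of `x`. -/
theorem exists_isotropic [Fact d.Prime] {m : ℕ} (hm : m ≤ n) (w : (Fin n → Alphabet d) → ℝ)
    (hw : ∀ x, 0 ≤ w x) (cost : (Fin n → Alphabet d) → ℝ) :
    ∃ L : AddSubgroup (Fin n → Alphabet d), (∀ u ∈ L, ∀ v ∈ L, symp u v = 0) ∧
      Nat.card L = d ^ m ∧
      ∑ x with ∃ x', x' ≠ x ∧ cost x' ≤ cost x ∧ x' - x ∈ orth L, w x ≤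
        ∑ x, w x * min 1 ((Finset.univ.filter fun x' => cost x' ≤ cost x).card / (d : ℝ) ^ m) := by
  set S := stdIsotropic d n m
  have hd : (0 : ℝ) < (d : ℝ) ^ m := pow_pos (Nat.cast_pos.2 (Fact.out : d.Prime).pos) m
  have hG : (0 : ℝ) < Fintype.card (sympGroup d n) := Nat.cast_pos.2 Fintype.card_pos
  have key (x : Fin n → Alphabet d) : ((Finset.univ.filter fun g : sympGroup d n =>
      ∃ x', x' ≠ x ∧ cost x' ≤ cost x ∧ x' - x ∈ orth (sympImage S g)).card : ℝ) ≤
      Fintype.card (sympGroup d n) *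
        min 1 ((Finset.univ.filter fun x' => cost x' ≤ cost x).card / (d : ℝ) ^ m) := by
    rw [mul_min_of_nonneg _ _ hG.le, mul_one]
    refine le_min (by exact_mod_cast Finset.card_le_univ _) ?_
    have h1 : (Finset.univ.filter fun g : sympGroup d n =>
        ∃ x', x' ≠ x ∧ cost x' ≤ cost x ∧ x' - x ∈ orth (sympImage S g)) ⊆
        ((Finset.univ.filter fun x' => cost x' ≤ cost x).erase x).biUnion fun x' =>
          Finset.univ.filter fun g : sympGroup d n => x' - x ∈ orth (sympImage S g) := by
      intro g hg
      obtain ⟨x', hx', hc, ho⟩ := (Finset.mem_filter.1 hg).2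
      exact Finset.mem_biUnion.2 ⟨x', Finset.mem_erase.2 ⟨hx', Finset.mem_filter.2
        ⟨Finset.mem_univ _, hc⟩⟩, Finset.mem_filter.2 ⟨Finset.mem_univ _, ho⟩⟩
    rw [mul_div_assoc', le_div_iff₀ hd]
    have h2 : (Finset.univ.filter fun g : sympGroup d n =>
        ∃ x', x' ≠ x ∧ cost x' ≤ cost x ∧ x' - x ∈ orth (sympImage S g)).card * d ^ m ≤
        Fintype.card (sympGroup d n) * (Finset.univ.filter fun x' => cost x' ≤ cost x).card := by
      calc _ ≤ (∑ x' ∈ (Finset.univ.filter fun x' => cost x' ≤ cost x).erase x,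
            (Finset.univ.filter fun g : sympGroup d n =>
              x' - x ∈ orth (sympImage S g)).card) * d ^ m :=
            Nat.mul_le_mul_right _ ((Finset.card_le_card h1).trans Finset.card_biUnion_le)
        _ ≤ ∑ x' ∈ (Finset.univ.filter fun x' => cost x' ≤ cost x).erase x,
              Fintype.card (sympGroup d n) := by
            rw [Finset.sum_mul]
            exact Finset.sum_le_sum fun x' hx' =>
              card_filter_mem_orth_le hm (sub_ne_zero.2 (Finset.ne_of_mem_erase hx'))
        _ ≤ _ := by
            rw [Finset.sum_const, smul_eq_mul, mul_comm]
            exact Nat.mul_le_mul_left _ (Finset.card_erase_le)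
    exact_mod_cast h2
  obtain ⟨g, -, hg⟩ := Finset.exists_le_of_sum_le (s := (Finset.univ : Finset (sympGroup d n)))
    (f := fun g => ∑ x with ∃ x', x' ≠ x ∧ cost x' ≤ cost x ∧ x' - x ∈ orth (sympImage S g), w x)
    (g := fun _ => ∑ x, w x *
      min 1 ((Finset.univ.filter fun x' => cost x' ≤ cost x).card / (d : ℝ) ^ m))
    ⟨1, Finset.mem_univ _⟩ (by
      simp only [Finset.sum_filter]
      rw [Finset.sum_comm, Finset.sum_const, Finset.card_univ, nsmul_eq_mul, Finset.mul_sum]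
      refine Finset.sum_le_sum fun x _ => ?_
      rw [← Finset.sum_filter, Finset.sum_const, nsmul_eq_mul, mul_comm, mul_left_comm]
      exact mul_le_mul_of_nonneg_left (key x) (hw x))
  refine ⟨sympImage S g, fun u hu v hv => ?_, ?_, hg⟩
  · rw [← (mem_sympGroup.1 (inv_mem g.2)).2]
    exact stdIsotropic_isotropic m _ hu _ hv
  · rw [card_sympImage, card_stdIsotropic hm]

end Isotropic

/-! ### The method of types -/

section Types

variable {α : Type} [DecidableEq α] {n : ℕ}

/-- The empirical distribution of a word. -/
def empirical (x : Fin n → α) (a : α) : ℝ := ((Finset.univ.filter fun i => x i = a).card : ℝ) / n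

theorem empirical_nonneg (x : Fin n → α) (a : α) : 0 ≤ empirical x a := by
  unfold empirical; positivity

variable [Fintype α]

theorem empirical_mem_stdSimplex (hn : 0 < n) (x : Fin n → α) :
    empirical x ∈ stdSimplex ℝ α := by
  refine ⟨empirical_nonneg x, ?_⟩
  simp only [empirical]
  rw [← Finset.sum_div, ← Nat.cast_sum,
    ← Finset.card_eq_sum_card_fiberwise fun i _ => Finset.mem_univ (x i)]
  simp [hn.ne']

theorem card_image_empirical_le :
    (Finset.univ.image (empirical : (Fin n → α) → α → ℝ)).card ≤ (n + 1) ^ Fintype.card α := by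
  classical
  have h : Finset.univ.image (empirical : (Fin n → α) → α → ℝ) ⊆
      Finset.univ.image fun (c : α → Fin (n + 1)) (a : α) => ((c a : ℕ) : ℝ) / n := by
    intro P hP
    obtain ⟨x, -, rfl⟩ := Finset.mem_image.1 hP
    refine Finset.mem_image.2 ⟨fun a => ⟨(Finset.univ.filter fun i => x i = a).card,
      Nat.lt_succ_of_le ((Finset.card_le_univ _).trans (by simp))⟩, Finset.mem_univ _, rfl⟩
  refine (Finset.card_le_card h).trans (Finset.card_image_le.trans ?_)
  simp

/-- The probability of a word depends only on its type. The condition `hx` is needed because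
`Real.logb m 0 = 0`. -/
theorem prod_eq_rpow {m : ℝ} (hm : 1 < m) (hn : 0 < n) {P : α → ℝ} (hP : ∀ a, 0 ≤ P a)
    (x : Fin n → α) (hx : ∀ a, P a = 0 → empirical x a = 0) :
    ∏ i, P (x i) = m ^ ((n : ℝ) * ∑ a, empirical x a * Real.logb m (P a)) := by
  have hn' : (n : ℝ) ≠ 0 := Nat.cast_ne_zero.2 hn.ne'
  have hm0 : 0 < m := by linarith
  rw [← Finset.prod_fiberwise' Finset.univ x P, Finset.mul_sum, Real.rpow_sum_of_pos hm0]
  refine Finset.prod_congr rfl fun a _ => ?_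
  rw [Finset.prod_const, ← mul_assoc, empirical, mul_div_cancel₀ _ hn']
  rcases (hP a).eq_or_lt with h | h
  · have h0 := hx a h.symm
    rw [empirical, div_eq_zero_iff, or_iff_left hn', Nat.cast_eq_zero] at h0
    simp [h0]
  · rw [mul_comm, Real.rpow_mul hm0.le, Real.rpow_logb hm0 hm.ne' h, Real.rpow_natCast]

/-- Under the product of the type itself, each word of the class has probability `m ^ (-n H)`, and
the total is at most 1. -/
theorem card_typeClass_le {m : ℝ} (hm : 1 < m) (hn : 0 < n) (x : Fin n → α) :
    ((Finset.univ.filter fun y : Fin n → α => empirical y = empirical x).card : ℝ) ≤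
      m ^ ((n : ℝ) * entropy m (empirical x)) := by
  have hm0 : 0 < m := by linarith
  have h1 : ∑ y : Fin n → α with empirical y = empirical x, ∏ i, empirical x (y i) ≤ 1 := by
    rw [← sum_prod_eq_one (n := n) (empirical_mem_stdSimplex hn x).2]
    exact Finset.sum_le_sum_of_subset_of_nonneg (Finset.filter_subset _ _)
      fun _ _ _ => Finset.prod_nonneg fun _ _ => empirical_nonneg _ _
  have h2 : ∑ y : Fin n → α with empirical y = empirical x, ∏ i, empirical x (y i) =
      ((Finset.univ.filter fun y : Fin n → α => empirical y = empirical x).card : ℝ) *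
        m ^ (-((n : ℝ) * entropy m (empirical x))) := by
    rw [← nsmul_eq_mul, ← Finset.sum_const]
    refine Finset.sum_congr rfl fun y hy => ?_
    have hy' := (Finset.mem_filter.1 hy).2
    rw [prod_eq_rpow hm hn (empirical_nonneg x) y fun a ha => by rw [hy', ha], hy', entropy]
    ring_nf
  rw [h2, Real.rpow_neg hm0.le, mul_inv_le_iff₀ (Real.rpow_pos_of_pos hm0 _), one_mul] at h1
  exact h1

theorem card_entropy_le {m : ℝ} (hm : 1 < m) (hn : 0 < n) (h : ℝ) :
    ((Finset.univ.filter fun y : Fin n → α => entropy m (empirical y) ≤ h).card : ℝ) ≤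
      ((n : ℝ) + 1) ^ Fintype.card α * m ^ ((n : ℝ) * h) := by
  classical
  have hmaps : ∀ y ∈ Finset.univ.filter fun y : Fin n → α => entropy m (empirical y) ≤ h,
      empirical y ∈ Finset.univ.image (empirical : (Fin n → α) → α → ℝ) := fun y _ =>
    Finset.mem_image_of_mem _ (Finset.mem_univ _)
  rw [Finset.card_eq_sum_card_fiberwise hmaps, Nat.cast_sum]
  calc _ ≤ ∑ _P ∈ Finset.univ.image (empirical : (Fin n → α) → α → ℝ), m ^ ((n : ℝ) * h) := by
        refine Finset.sum_le_sum fun P hP => ?_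
        obtain ⟨x, -, rfl⟩ := Finset.mem_image.1 hP
        by_cases hx : entropy m (empirical x) ≤ h
        · calc _ ≤ ((Finset.univ.filter fun y : Fin n → α =>
                empirical y = empirical x).card : ℝ) := by
                rw [Finset.filter_filter]
                refine Nat.cast_le.2 (Finset.card_le_card fun y hy => ?_)
                exact Finset.mem_filter.2 ⟨Finset.mem_univ _, (Finset.mem_filter.1 hy).2.2⟩
            _ ≤ _ := card_typeClass_le hm hn x
            _ ≤ _ := Real.rpow_le_rpow_of_exponent_le hm.le
                (mul_le_mul_of_nonneg_left hx (Nat.cast_nonneg _))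
        · rw [Finset.filter_filter, Finset.filter_eq_empty_iff.2, Finset.card_empty, Nat.cast_zero]
          · exact Real.rpow_nonneg (by linarith) _
          · rintro y - ⟨h1, h2⟩
            exact hx (h2 ▸ h1)
    _ ≤ _ := by
        rw [Finset.sum_const, nsmul_eq_mul]
        refine mul_le_mul_of_nonneg_right ?_ (Real.rpow_nonneg (by linarith) _)
        exact_mod_cast card_image_empirical_le

/-- The class size `m ^ (n H)` times the common word probability gives the divergence. The `max`
mirrors the truncation in `divergence`: where it selects 0, the trivial bound 1 suffices and Gibbs'
inequality is not needed. -/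
theorem sum_typeClass_le {m : ℝ} (hm : 1 < m) (hn : 0 < n) {P : α → ℝ} (hP : P ∈ stdSimplex ℝ α)
    (x : Fin n → α) (hx : ∀ a, P a = 0 → empirical x a = 0) :
    ∑ y : Fin n → α with empirical y = empirical x, ∏ i, P (y i) ≤
      m ^ (-(n : ℝ) * max (∑ a, empirical x a * Real.logb m (empirical x a / P a)) 0) := by
  have hm0 : 0 < m := by linarith
  have hnn : -(n : ℝ) ≤ 0 := neg_nonpos.2 (Nat.cast_nonneg n)
  rcases max_choice (∑ a, empirical x a * Real.logb m (empirical x a / P a)) 0 with h | h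
  · rw [h]
    have h1 : ∑ y : Fin n → α with empirical y = empirical x, ∏ i, P (y i) =
        ((Finset.univ.filter fun y : Fin n → α => empirical y = empirical x).card : ℝ) *
          m ^ ((n : ℝ) * ∑ a, empirical x a * Real.logb m (P a)) := by
      rw [← nsmul_eq_mul, ← Finset.sum_const]
      refine Finset.sum_congr rfl fun y hy => ?_
      have hy' := (Finset.mem_filter.1 hy).2
      rw [prod_eq_rpow hm hn hP.1 y fun a ha => by rw [hy', hx a ha], hy']
    rw [h1]
    refine (mul_le_mul_of_nonneg_right (card_typeClass_le hm hn x)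
      (Real.rpow_nonneg hm0.le _)).trans (le_of_eq ?_)
    rw [← Real.rpow_add hm0]
    congr 1
    have h2 (a : α) : empirical x a * Real.logb m (empirical x a / P a) =
        empirical x a * Real.logb m (empirical x a) - empirical x a * Real.logb m (P a) := by
      by_cases hP0 : P a = 0
      · simp [hx a hP0]
      by_cases he : empirical x a = 0
      · simp [he]
      rw [Real.logb_div he hP0, mul_sub]
    simp only [h2, Finset.sum_sub_distrib, entropy]
    ring
  · rw [h, mul_zero, Real.rpow_zero, ← sum_prod_eq_one (n := n) hP.2]
    exact Finset.sum_le_sum_of_subset_of_nonneg (Finset.filter_subset _ _)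
      fun _ _ _ => Finset.prod_nonneg fun _ _ => hP.1 _

theorem min_one_le {m : ℝ} (hm : 1 < m) {t : ℝ} (ht : 1 ≤ t) {s b : ℝ} (h : b ≤ t * m ^ (1 - s)) :
    min 1 b ≤ t * m * m ^ (-max s 0) := by
  have hm0 : 0 < m := by linarith
  rcases max_choice s 0 with h1 | h1
  · rw [h1]
    refine (min_le_right _ _).trans (h.trans (le_of_eq ?_))
    rw [sub_eq_add_neg, Real.rpow_add hm0, Real.rpow_one, mul_assoc]
  · rw [h1, neg_zero, Real.rpow_zero, mul_one]
    exact (min_le_left _ _).trans (by nlinarith)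

/-- The error bound of the minimum entropy decoder with random isotropic groups. -/
theorem sum_min_le {m : ℕ} (hm : 1 < m) (hn : 0 < n) {P : α → ℝ} (hP : P ∈ stdSimplex ℝ α)
    {R E : ℝ} (hE : ∀ V ∈ stdSimplex ℝ α, (∀ a, P a = 0 → V a = 0) →
      E ≤ max (∑ a, V a * Real.logb m (V a / P a)) 0 + max (1 - entropy m V - R) 0)
    {k : ℕ} (hk : k ≤ n) (hkR : (k : ℝ) ≤ n * R + 1) :
    ∑ x : Fin n → α, (∏ i, P (x i)) * min 1 ((Finset.univ.filter fun y : Fin n → α =>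
      entropy m (empirical y) ≤ entropy m (empirical x)).card / (m : ℝ) ^ (n - k)) ≤
      ((n : ℝ) + 1) ^ (2 * Fintype.card α) * m * (m : ℝ) ^ (-(n * E)) := by
  classical
  have hm' : (1 : ℝ) < m := by exact_mod_cast hm
  have hm0 : (0 : ℝ) < m := by linarith
  have hn' : (0 : ℝ) < n := Nat.cast_pos.2 hn
  set t : ℝ := ((n : ℝ) + 1) ^ Fintype.card α with ht
  have ht1 : 1 ≤ t := one_le_pow₀ (by linarith)
  have hterm (x : Fin n → α) : min 1 ((Finset.univ.filter fun y : Fin n → α =>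
      entropy m (empirical y) ≤ entropy m (empirical x)).card / (m : ℝ) ^ (n - k)) ≤
      t * m * (m : ℝ) ^ (-(n * max (1 - entropy m (empirical x) - R) 0)) := by
    -- The 1 in the exponent `1 - s` of `min_one_le` absorbs the rounding `k ≤ n R + 1`, at the cost
    -- of one factor `m`.
    have h := min_one_le hm' ht1 (s := n * (1 - entropy m (empirical x) - R))
      (b := (Finset.univ.filter fun y : Fin n → α =>
        entropy m (empirical y) ≤ entropy m (empirical x)).card / (m : ℝ) ^ (n - k)) (by
        rw [div_le_iff₀ (by positivity), ← Real.rpow_natCast (m : ℝ) (n - k), mul_assoc,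
          ← Real.rpow_add hm0]
        refine (card_entropy_le hm' hn _).trans (mul_le_mul_of_nonneg_left
          (Real.rpow_le_rpow_of_exponent_le hm'.le ?_) (by linarith))
        rw [Nat.cast_sub hk]
        linarith)
    rwa [mul_max_of_nonneg _ _ hn'.le, mul_zero]
  have hmaps : ∀ x ∈ (Finset.univ : Finset (Fin n → α)),
      empirical x ∈ Finset.univ.image (empirical : (Fin n → α) → α → ℝ) := fun x _ =>
    Finset.mem_image_of_mem _ (Finset.mem_univ _)
  rw [← Finset.sum_fiberwise_of_maps_to hmaps]
  have hclass : ∀ V ∈ Finset.univ.image (empirical : (Fin n → α) → α → ℝ),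
      ∑ x : Fin n → α with empirical x = V, (∏ i, P (x i)) * min 1 ((Finset.univ.filter fun y : Fin n → α =>
        entropy m (empirical y) ≤ entropy m (empirical x)).card / (m : ℝ) ^ (n - k)) ≤
      t * m * (m : ℝ) ^ (-(n * E)) := by
    intro V hV
    obtain ⟨x₀, -, rfl⟩ := Finset.mem_image.1 hV
    have h1 : ∑ x : Fin n → α with empirical x = empirical x₀, (∏ i, P (x i)) *
        min 1 ((Finset.univ.filter fun y : Fin n → α =>
          entropy m (empirical y) ≤ entropy m (empirical x)).card / (m : ℝ) ^ (n - k)) ≤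
        (∑ x : Fin n → α with empirical x = empirical x₀, ∏ i, P (x i)) *
          (t * m * (m : ℝ) ^ (-(n * max (1 - entropy m (empirical x₀) - R) 0))) := by
      rw [Finset.sum_mul]
      refine Finset.sum_le_sum fun x hx => ?_
      rw [← (Finset.mem_filter.1 hx).2]
      exact mul_le_mul_of_nonneg_left (hterm x) (Finset.prod_nonneg fun _ _ => hP.1 _)
    refine h1.trans ?_
    by_cases hac : ∀ a, P a = 0 → empirical x₀ a = 0
    · refine (mul_le_mul_of_nonneg_right (sum_typeClass_le hm' hn hP x₀ hac)
        (by positivity)).trans ?_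
      rw [mul_left_comm, ← Real.rpow_add hm0]
      refine mul_le_mul_of_nonneg_left (Real.rpow_le_rpow_of_exponent_le hm'.le ?_) (by positivity)
      have := mul_le_mul_of_nonneg_left (hE _ (empirical_mem_stdSimplex hn x₀) hac) hn'.le
      linarith
    -- A type charging a letter of probability zero has no mass.
    · push Not at hac
      obtain ⟨a, ha, hne⟩ := hac
      rw [Finset.sum_eq_zero, zero_mul]
      · positivity
      · intro x hx
        rw [← (Finset.mem_filter.1 hx).2, empirical, Ne, div_eq_zero_iff,
          or_iff_left hn'.ne', Nat.cast_eq_zero, ← Ne, Finset.card_ne_zero] at hne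
        obtain ⟨i, hi⟩ := hne
        exact Finset.prod_eq_zero (Finset.mem_univ i) (by rw [(Finset.mem_filter.1 hi).2, ha])
  refine (Finset.sum_le_sum hclass).trans ?_
  -- One factor `t` counts the types, the other comes from `card_entropy_le`; hence the exponent `2
  -- * Fintype.card α`.
  rw [Finset.sum_const, nsmul_eq_mul, two_mul, pow_add, ← ht, mul_assoc t t, mul_assoc t (t * m),
    mul_assoc t m]
  rw [← mul_assoc t (m : ℝ)]
  refine mul_le_mul_of_nonneg_right ?_ (by positivity)
  rw [ht]
  exact_mod_cast card_image_empirical_le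

end Types

/-! ### The random coding exponent -/

section Exponent

variable {d : ℕ} [NeZero d]

theorem QDMC.prob_mem_stdSimplex (W : QDMC d) : W.prob ∈ stdSimplex ℝ (Alphabet d) :=
  ⟨W.prob_nonneg, W.sum_prob⟩

theorem QDMC.divergence_prob (W : QDMC d) : divergence d W.prob W.prob = 0 := by
  rw [divergence, if_pos fun _ h => h, ENNReal.ofReal_eq_zero]
  refine le_of_eq (Finset.sum_eq_zero fun x _ => ?_)
  by_cases h : W.prob x = 0
  · simp [h]
  · simp [div_self h]

theorem randomCodingTerm_prob_ne_top (W : QDMC d) (R : ℝ) : randomCodingTerm d W R W.prob ≠ ⊤ := by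
  rw [randomCodingTerm, W.divergence_prob, zero_add]
  exact ENNReal.ofReal_ne_top

theorem randomCodingExponent_le (W : QDMC d) (R : ℝ) {V : Alphabet d → ℝ}
    (hV : V ∈ stdSimplex ℝ (Alphabet d)) :
    randomCodingExponent d W R ≤ randomCodingTerm d W R V := iInf₂_le V hV

theorem randomCodingExponent_ne_top (W : QDMC d) (R : ℝ) : randomCodingExponent d W R ≠ ⊤ :=
  ne_top_of_le_ne_top (randomCodingTerm_prob_ne_top W R)
    (randomCodingExponent_le W R W.prob_mem_stdSimplex)

theorem toReal_randomCodingExponent_le (W : QDMC d) (R : ℝ) {V : Alphabet d → ℝ}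
    (hV : V ∈ stdSimplex ℝ (Alphabet d)) (h : ∀ x, W.prob x = 0 → V x = 0) :
    (randomCodingExponent d W R).toReal ≤
      max (∑ x, V x * Real.logb d (V x / W.prob x)) 0 + max (1 - entropy d V - R) 0 := by
  refine ENNReal.toReal_le_of_le_ofReal (by positivity)
    ((randomCodingExponent_le W R hV).trans (le_of_eq ?_))
  have e (a : ℝ) : ENNReal.ofReal (max a 0) = ENNReal.ofReal a := by
    rw [ENNReal.ofReal_max, ENNReal.ofReal_zero, max_eq_left zero_le]
  rw [randomCodingTerm, divergence, if_pos h,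
    ENNReal.ofReal_add (le_max_right _ _) (le_max_right _ _), e, e]

theorem entropy_nonneg {m : ℝ} (hm : 1 < m) {α : Type} [Fintype α] {P : α → ℝ}
    (hP : P ∈ stdSimplex ℝ α) : 0 ≤ entropy m P := by
  rw [entropy, neg_nonneg]
  refine Finset.sum_nonpos fun x _ => mul_nonpos_of_nonneg_of_nonpos (hP.1 x) ?_
  exact Real.logb_nonpos hm (hP.1 x)
    (hP.2 ▸ Finset.single_le_sum (fun y _ => hP.1 y) (Finset.mem_univ x))

/-- At `V = W` the divergence vanishes, and `1 - H(V) - R ≤ 0`. -/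
theorem randomCodingExponent_eq_zero (hd : 1 < d) (W : QDMC d) {R : ℝ} (hR : 1 ≤ R) :
    randomCodingExponent d W R = 0 := by
  refine le_antisymm ((randomCodingExponent_le W R W.prob_mem_stdSimplex).trans (le_of_eq ?_))
    (zero_le)
  have := entropy_nonneg (m := d) (by exact_mod_cast hd) W.prob_mem_stdSimplex
  rw [randomCodingTerm, W.divergence_prob, zero_add, max_eq_right (by linarith),
    ENNReal.ofReal_zero]

/-- The term is infinite off the face of distributions vanishing where `W` does; on this compact
face it is continuous. -/
theorem exists_randomCodingTerm_eq (W : QDMC d) (R : ℝ) :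
    ∃ V ∈ stdSimplex ℝ (Alphabet d), randomCodingTerm d W R V = randomCodingExponent d W R := by
  set K := stdSimplex ℝ (Alphabet d) ∩ ⋂ x, {V | W.prob x = 0 → V x = 0} with hK
  have hKc : IsCompact K := (isCompact_stdSimplex ℝ (Alphabet d)).inter_right
    (isClosed_iInter fun x => by
      by_cases h : W.prob x = 0
      · simpa [h] using isClosed_eq (continuous_apply x) continuous_const
      · simp [h])
  have hKmem (V : Alphabet d → ℝ) :
      V ∈ K ↔ V ∈ stdSimplex ℝ (Alphabet d) ∧ ∀ x, W.prob x = 0 → V x = 0 := by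
    simp [hK]
  have hne : K.Nonempty := ⟨W.prob, (hKmem _).2 ⟨W.prob_mem_stdSimplex, fun _ h => h⟩⟩
  -- Splitting the logarithm of the quotient leaves `t log t`, which is continuous at 0, and a part
  -- linear in `V`.
  set f : (Alphabet d → ℝ) → ℝ≥0∞ := fun V =>
    ENNReal.ofReal (∑ x, (V x * Real.log (V x) - V x * Real.log (W.prob x)) / Real.log d) +
      ENNReal.ofReal (max (1 - -∑ x, V x * Real.log (V x) / Real.log d - R) 0) with hf
  have hlog (x : Alphabet d) : Continuous fun V : Alphabet d → ℝ => V x * Real.log (V x) :=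
    Real.continuous_mul_log.comp (continuous_apply x)
  have hfc : Continuous f := by
    refine (ENNReal.continuous_ofReal.comp ?_).add (ENNReal.continuous_ofReal.comp ?_)
    · exact continuous_finsetSum _ fun x _ =>
        ((hlog x).sub ((continuous_apply x).mul continuous_const)).div_const _
    · exact ((continuous_const.sub (continuous_finsetSum _ fun x _ =>
        (hlog x).div_const _).neg).sub continuous_const).max continuous_const
  have hfK : ∀ V ∈ K, randomCodingTerm d W R V = f V := by
    intro V hV
    have h := ((hKmem V).1 hV).2
    rw [randomCodingTerm, divergence, if_pos h, hf, entropy]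
    simp only [Real.logb, mul_div_assoc]
    congr 2
    refine Finset.sum_congr rfl fun x _ => ?_
    by_cases h0 : V x = 0
    · simp [h0]
    · rw [Real.log_div h0 fun h1 => h0 (h x h1)]
      ring
  obtain ⟨V, hVK, hmin⟩ := hKc.exists_isMinOn hne hfc.continuousOn
  refine ⟨V, ((hKmem V).1 hVK).1, le_antisymm (le_iInf₂ fun V' hV' => ?_)
    (randomCodingExponent_le W R ((hKmem V).1 hVK).1)⟩
  by_cases h : ∀ x, W.prob x = 0 → V' x = 0
  · have hV'K := (hKmem V').2 ⟨hV', h⟩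
    rw [hfK V hVK, hfK V' hV'K]
    exact hmin hV'K
  · refine le_of_le_of_eq le_top ?_
    rw [randomCodingTerm, divergence, if_neg h, top_add]

end Exponent

/-! ### The achievability of the random coding exponent -/

section Achievability

variable {d : ℕ} [Fact d.Prime]

/-- Leaders are cheapest in their syndrome class. If decoding `v` fails, the leader is another word,
no dearer than `v`, differing from it by a vector orthogonal to `L`: exactly the confusion bounded
by `exists_isotropic`. -/
theorem exists_code_of_cost {ω : ℂ} (hω : IsPrimitiveRoot ω d) (W : QDMC d) {n k : ℕ} (hk : k ≤ n)
    (cost : (Fin n → Alphabet d) → ℝ) :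
    ∃ (Q : Submodule ℂ (Space d n)) (Rec : Op d n →ₗ[ℂ] Op d n), IsCPTP Rec ∧
      Module.finrank ℂ Q = d ^ k ∧
      1 - fidelity ω W Q Rec ≤ ∑ x, W.probPow x *
        min 1 ((Finset.univ.filter fun x' => cost x' ≤ cost x).card / (d : ℝ) ^ (n - k)) := by
  classical
  obtain ⟨L, hL, hcard, hsum⟩ := exists_isotropic (Nat.sub_le n k) W.probPow W.probPow_nonneg cost
  set σ := syndrome (AddChar.zmodChar d hω.pow_eq_one) L with hσ
  have hleader (τ : AddChar L ℂ) : ∃ w, ∀ v, σ v = τ → σ w = τ ∧ cost w ≤ cost v := by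
    by_cases h : (Finset.univ.filter fun v => σ v = τ).Nonempty
    · obtain ⟨w, hw, hmin⟩ := Finset.exists_min_image _ cost h
      exact ⟨w, fun v hv => ⟨(Finset.mem_filter.1 hw).2,
        hmin v (Finset.mem_filter.2 ⟨Finset.mem_univ _, hv⟩)⟩⟩
    · exact ⟨0, fun v hv => absurd ⟨v, Finset.mem_filter.2 ⟨Finset.mem_univ _, hv⟩⟩ h⟩
  choose r hr using hleader
  set Γ := Finset.univ.filter fun v => v - r (σ v) ∈ L
  obtain ⟨Q, Rec, hRec, hQ, hF⟩ := exists_code hω W hL r (fun v => (hr _ v rfl).1) Γ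
    (fun v hv => (Finset.mem_filter.1 hv).2)
  have hd : 0 < d := (Fact.out : d.Prime).pos
  refine ⟨Q, Rec, hRec, ?_, ?_⟩
  · rw [← Nat.card_eq_fintype_card, hcard] at hQ
    refine Nat.eq_of_mul_eq_mul_right (pow_pos hd (n - k)) ?_
    rw [hQ, ← pow_add, Nat.add_sub_cancel' hk]
  refine le_trans ?_ hsum
  have h1 : 1 = ∑ v ∈ Γ, W.probPow v +
      ∑ v with ¬ (v - r (σ v) ∈ L), W.probPow v := by
    rw [Finset.sum_filter_add_sum_filter_not, W.sum_probPow]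
  have h2 : ∑ v with ¬ (v - r (σ v) ∈ L), W.probPow v ≤
      ∑ x with ∃ x', x' ≠ x ∧ cost x' ≤ cost x ∧ x' - x ∈ orth L, W.probPow x := by
    refine Finset.sum_le_sum_of_subset_of_nonneg (fun v hv => ?_) fun _ _ _ => W.probPow_nonneg _
    refine Finset.mem_filter.2 ⟨Finset.mem_univ _, r (σ v), fun h => ?_, (hr _ v rfl).2, ?_⟩
    · have := (Finset.mem_filter.1 hv).2
      rw [h, sub_self] at this
      exact this L.zero_mem
    · refine (syndrome_eq_iff (fun a ha => ?_) _ _).1 (hr _ v rfl).1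
      exact eq_zero_of_zmodChar_eq_one hω ha
  linarith

theorem exponent_anti {n : ℕ} {ε ε' : ℝ} (h : ε ≤ ε') : exponent d n ε' ≤ exponent d n ε := by
  unfold exponent
  have hd : (1 : ℝ) < d := by exact_mod_cast (Fact.out : d.Prime).one_lt
  split_ifs with h1 h2 h2
  · exact le_rfl
  · linarith
  · exact le_top
  · exact ENNReal.ofReal_le_ofReal (mul_le_mul_of_nonpos_left
      (Real.logb_le_logb_of_le hd (by linarith) h)
      (neg_nonpos.2 (by positivity)))

theorem le_errorExponent {ω : ℂ} (hω : IsPrimitiveRoot ω d) (W : QDMC d) {R : ℝ} (hR : 0 ≤ R)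
    (hR1 : R < 1) {n : ℕ} (hn : 0 < n) :
    ENNReal.ofReal ((randomCodingExponent d W R).toReal -
      ((2 * Fintype.card (Alphabet d) : ℕ) * Real.logb d (n + 1) + 1) / n) ≤
      errorExponent d ω W n R := by
  have hd : (1 : ℝ) < d := by exact_mod_cast (Fact.out : d.Prime).one_lt
  have hd0 : (0 : ℝ) < d := by linarith
  have hn' : (0 : ℝ) < n := Nat.cast_pos.2 hn
  -- The least dimension exponent with rate at least `R`; `R < 1` ensures `k ≤ n`.
  set k := ⌈n * R⌉₊
  have hkn : k ≤ n := Nat.ceil_le.2 (by nlinarith)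
  have hkR : (k : ℝ) ≤ n * R + 1 := (Nat.ceil_lt_add_one (by positivity)).le
  obtain ⟨Q, Rec, hRec, hQ, hF⟩ := exists_code_of_cost hω W hkn
    fun x => entropy d (empirical x)
  have hbound := hF.trans (sum_min_le (Fact.out : d.Prime).one_lt hn W.prob_mem_stdSimplex
    (fun V hV h => toReal_randomCodingExponent_le W R hV h) hkn hkR)
  have hQ0 : Q ≠ ⊥ := by
    rintro rfl
    rw [finrank_bot] at hQ
    exact (pow_pos (Fact.out : d.Prime).pos k).ne hQ
  have hrate : R ≤ rate Q := by
    rw [rate, hQ, Nat.cast_pow, Real.logb_pow, Real.logb_self_eq_one hd, mul_one,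
      le_div_iff₀ hn', mul_comm]
    exact Nat.le_ceil _
  refine le_trans ?_ (le_iSup₂_of_le Q hQ0 (le_iSup₂_of_le hrate Rec (le_iSup_of_le hRec le_rfl)))
  refine le_trans ?_ (exponent_anti hbound)
  rw [exponent, if_neg (not_le.2 (by positivity))]
  refine ENNReal.ofReal_le_ofReal (le_of_eq ?_)
  rw [Real.logb_mul (by positivity) (by positivity), Real.logb_mul (by positivity) hd0.ne',
    Real.logb_self_eq_one hd, Real.logb_rpow hd0 hd.ne', Real.logb_pow]
  field_simp
  ring

theorem tendsto_log_succ_div (a m : ℝ) :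
    Tendsto (fun n : ℕ => (a * Real.logb m ((n : ℝ) + 1) + 1) / n) atTop (nhds 0) := by
  have h1 : Tendsto (fun n : ℕ => Real.log ((n : ℝ) + 1) / n) atTop (nhds 0) := by
    have := (Real.tendsto_pow_log_div_mul_add_atTop 1 (-1) 1 one_ne_zero).comp
      (tendsto_natCast_atTop_atTop.atTop_add (tendsto_const_nhds (x := (1 : ℝ))))
    refine this.congr fun n => ?_
    simp
  have h2 := (h1.const_mul (a / Real.log m)).add (tendsto_one_div_atTop_nhds_zero_nat (𝕜 := ℝ))
  rw [mul_zero, add_zero] at h2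
  refine h2.congr fun n => ?_
  rw [Real.logb]
  ring

theorem randomCodingExponent_le_reliability {ω : ℂ} (hω : IsPrimitiveRoot ω d) (W : QDMC d) {R : ℝ}
    (hR : 0 ≤ R) : randomCodingExponent d W R ≤ reliability d ω W R := by
  -- For `R ≥ 1` the exponent is zero, so no code is needed.
  rcases le_or_gt 1 R with hR1 | hR1
  · rw [randomCodingExponent_eq_zero (Fact.out : d.Prime).one_lt W hR1]
    exact zero_le
  have h := (tendsto_log_succ_div (2 * Fintype.card (Alphabet d) : ℕ) d).const_sub
    (randomCodingExponent d W R).toReal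
  rw [sub_zero] at h
  have h' := (ENNReal.continuous_ofReal.tendsto _).comp h
  rw [ENNReal.ofReal_toReal (randomCodingExponent_ne_top W R)] at h'
  rw [← h'.liminf_eq]
  exact liminf_le_liminf ((eventually_gt_atTop 0).mono fun n hn => le_errorExponent hω W hR hR1 hn)

end Achievability

end
end QDM

theorem theorem1 (d : ℕ) [Fact d.Prime] (ω : ℂ) (hω : IsPrimitiveRoot ω d)
    (W : QDM.QDMC d) (R : ℝ) (hR : 0 ≤ R) :
    (∃ V ∈ stdSimplex ℝ (QDM.Alphabet d),
      QDM.randomCodingTerm d W R V = QDM.randomCodingExponent d W R) ∧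
    QDM.randomCodingExponent d W R ≤ QDM.reliability d ω W R := by
  exact ⟨QDM.exists_randomCodingTerm_eq W R, QDM.randomCodingExponent_le_reliability hω W hR⟩
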